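/- **Setting.** A *bcm space* is a non-empty metric space whose closed balls are compact; a *rooted* bcm space $(X,\rho_X)$ is a bcm space $X$ with a point $\rho_X\in X$. Isometric embeddings are distance-preserving maps (not necessarily onto). A *structure* $\tau$ is a functor from bcm spaces with isometric embeddings to metrizable topological spaces with topological embeddings: it assigns to each bcm space $X$ a metrizable space $\tau(X)$ and to each isometric embedding $f\colon X\to Y$ a topological embedding $\tau_f\colon\tau(X)\to\tau(Y)$, with $\tau_{\mathrm{id}}=\mathrm{id}$ and $\tau_{g\circ f}=\tau_g\circ\tau_f$. Write $\tau^\times(X)=\tau(X)\times X$, $\tau^\times_f=\tau_f\times f$ (product topology). An *element-rooted metrization* $E$ of $\tau$ assigns to every bcm space $X$ a metric $d^E_X$ on the non-empty space $\tau(X)\times X$ inducing the product topology such that every $\tau_f\times f$ preserves distances. A *space-rooted metrization* $S$ of $\tau$ assigns to every rooted bcm space $(X,\rho)$ a metric $d^S_{X,\rho}$ on the non-empty space $\tau(X)$ inducing its topology such that $\tau_f$ preserves distances for every root-preserving isometric embedding $f$; it is *complete* if all $d^S_{X,\rho}$ are complete. $\tau$ is *stably metrizable* if it has an element-rooted metrization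 $E$ and a function $D\colon[0,\infty)\to[0,\infty)$ with $\lim_{\varepsilon\to0}D(\varepsilon)=D(0)=0$ such that, for all bcm spaces $X,Y,M_1,M_2$, isometric embeddings $f_i\colon X\to M_i$, $g_i\colon Y\to M_i$ $(i=1,2)$ and $\varepsilon\ge0$: if $d_{M_2}(f_2(x),g_2(y))\le d_{M_1}(f_1(x),g_1(y))+\varepsilon$ for all $x\in X,y\in Y$, then $d^E_{M_2}(\tau^\times_{f_2}(a),\tau^\times_{g_2}(b))\le d^E_{M_1}(\tau^\times_{f_1}(a),\tau^\times_{g_1}(b))+D(\varepsilon)$ for all $a\in\tau^\times(X)$, $b\in\tau^\times(Y)$. A structure $\tau$ is *continuous* if (a) $\tau_{f_n}(a)\to\tau_f(a)$ for all $a\in\tau(X)$ whenever isometric embeddings $f_n\colon X\to Y$ converge to an isometric embedding $f$ uniformly on compact sets, and, whenever bcm spaces $X_n$ and $X_\infty$ are isometrically embedded in a bcm space $Y$ by $f_n$ and $f_\infty$ with $f_n(X_n)\to f_\infty(X_\infty)$ in the Fell topology, (b) every limit in $\tau(Y)$ of a convergent sequence $\tau_{f_n}(a_n)$, $a_n\in\tau(X_n)$,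 lies in $\tau_{f_\infty}(\tau(X_\infty))$, and (c) for every $a\in\tau(X_\infty)$ there are a subsequence $(n_k)$ and $a_k\in\tau(X_{n_k})$ with $\tau_{f_{n_k}}(a_k)\to\tau_{f_\infty}(a)$. It is *separable* if every $\tau(X)$ is separable. $\tau$ is *Polish with preserved roots* if there are a continuous, separable structure $\tilde\tau$ admitting a complete space-rooted metrization, a natural transformation $\eta\colon\tau\Rightarrow\tilde\tau$ by topological embeddings, and, for $k\ge1$ and every rooted bcm space $(X,\rho)$, open subsets $\tilde\tau_k(X,\rho)\subseteq\tilde\tau(X)$ with $\tilde\tau_f^{-1}(\tilde\tau_k(Y,\rho_Y))=\tilde\tau_k(X,\rho_X)$ for all root-preserving isometric embeddings $f\colon X\to Y$, such that $\eta_X(\tau(X))=\bigcap_{k\ge1}\tilde\tau_k(X,\rho)$ for every $(X,\rho)$. Let $\mathfrak M_\bullet(\tau)$ be the set of triples $(X,\rho_X,a_X)$, with $(X,\rho_X)$ a rooted bcm space and $a_X\in\tau(X)$, where $(X,\rho_X,a_X)$ and $(Y,\rho_Y,a_Y)$ are identified if $f(\rho_X)=\rho_Y$ and $\tau_f(a_X)=a_Y$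 for some bijective isometry $f\colon X\to Y$. For closed subsets $A,B$ of a bcm space $Z$ and $x,y\in Z$ put $$I_Z(A,x;B,y)=\int_0^\infty e^{-r}\bigl(1\wedge d_{\mathrm H}(A\cap D(x,r),B\cap D(y,r))\bigr)\,dr,$$ where $D(x,r)$ is the closed ball and $d_{\mathrm H}$ the Hausdorff distance. For $\mathcal X=(X,\rho_X,a_X)$ and $\mathcal Y=(Y,\rho_Y,a_Y)$ define $$d^S_{\mathrm{pres}}(\mathcal X,\mathcal Y)=\inf\bigl\{I_Z(f(X),\rho_Z;g(Y),\rho_Z)\vee d^S_{Z,\rho_Z}(\tau_f(a_X),\tau_g(a_Y))\bigr\},$$ the infimum being over all rooted bcm spaces $(Z,\rho_Z)$ and root-preserving isometric embeddings $f\colon X\to Z$, $g\colon Y\to Z$, and $$d^E_{\mathrm{non}}(\mathcal X,\mathcal Y)=\inf\bigl\{d_Z(f(\rho_X),g(\rho_Y))\vee I_Z(f(X),f(\rho_X);g(Y),g(\rho_Y))\vee d^E_Z(\tau^\times_f(a_X,\rho_X),\tau^\times_g(a_Y,\rho_Y))\bigr\},$$ the infimum being over all bcm spaces $Z$ and isometric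 embeddings $f\colon X\to Z$, $g\colon Y\to Z$. The local GH-type topology with preserved roots (resp. with non-preserved roots) on $\mathfrak M_\bullet(\tau)$ is the one induced by $d^S_{\mathrm{pres}}$ (resp. $d^E_{\mathrm{non}}$). **Theorem.** Suppose that a structure $\tau$ is stably metrizable and Polish with preserved roots. Then $\tau$ has space-rooted and element-rooted metrizations, and for every space-rooted metrization $S$ and every element-rooted metrization $E$ of $\tau$, the functions $d^S_{\mathrm{pres}}$ and $d^E_{\mathrm{non}}$ are metrics on $\mathfrak M_\bullet(\tau)$ that induce the same topology; that is, the local GH-type topologies with preserved and with non-preserved roots coincide. This common topology is Polish. -/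

import Mathlib

open CategoryTheory Filter Topology

universe u v w w'

/-! ### The categories of boundedly compact spaces and of metrizable spaces -/

/-- A boundedly compact metric space: a non-empty metric space whose closed balls are compact. -/
structure BCM : Type (u + 1) where
  carrier : Type u
  [metricSpace : MetricSpace carrier]
  [properSpace : ProperSpace carrier]
  [nonempty : Nonempty carrier]

namespace BCM

instance : CoeSort BCM.{u} (Type u) := ⟨BCM.carrier⟩

attribute [instance] BCM.metricSpace BCM.properSpace BCM.nonempty

/-- Isometric embeddings (distance preserving, not necessarily surjective). -/
@[ext]
structure Hom (X Y : BCM.{u}) : Type u where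
  toFun : X → Y
  isometry : Isometry toFun

instance : Category BCM.{u} where
  Hom := Hom
  id X := ⟨fun x => x, isometry_id⟩
  comp f g := ⟨fun x => g.toFun (f.toFun x), g.isometry.comp f.isometry⟩

instance {X Y : BCM.{u}} : CoeFun (X ⟶ Y) (fun _ => X → Y) := ⟨fun f => f.toFun⟩

end BCM

/-- A rooted boundedly compact metric space. -/
structure RootedBCM : Type (u + 1) where
  toBCM : BCM.{u}
  root : toBCM

namespace RootedBCM

/-- Root-preserving isometric embeddings. -/
@[ext]
structure Hom (X Y : RootedBCM.{u}) : Type u where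
  toHom : X.toBCM ⟶ Y.toBCM
  map_root : toHom X.root = Y.root

instance : Category RootedBCM.{u} where
  Hom := Hom
  id X := ⟨𝟙 X.toBCM, rfl⟩
  comp f g := ⟨f.toHom ≫ g.toHom,
    (congrArg g.toHom.toFun f.map_root).trans g.map_root⟩

end RootedBCM

/-- A (bundled) metrizable topological space. -/
structure MTop : Type (v + 1) where
  carrier : Type v
  [topologicalSpace : TopologicalSpace carrier]
  [metrizableSpace : TopologicalSpace.MetrizableSpace carrier]

namespace MTop

instance : CoeSort MTop.{v} (Type v) := ⟨MTop.carrier⟩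

attribute [instance] MTop.topologicalSpace MTop.metrizableSpace

/-- Topological embeddings. -/
@[ext]
structure Hom (X Y : MTop.{v}) : Type v where
  toFun : X → Y
  isEmbedding : IsEmbedding toFun

instance : Category MTop.{v} where
  Hom := Hom
  id X := ⟨fun x => x, IsEmbedding.id⟩
  comp f g := ⟨fun x => g.toFun (f.toFun x), g.isEmbedding.comp f.isEmbedding⟩

instance {X Y : MTop.{v}} : CoeFun (X ⟶ Y) (fun _ => X → Y) := ⟨fun f => f.toFun⟩

end MTop

/-- The functor forgetting the root. -/
def forgetRoot : RootedBCM.{u} ⥤ BCM.{u} where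
  obj X := X.toBCM
  map f := f.toHom

/-- A structure: a functor from boundedly compact spaces with isometric embeddings
to metrizable spaces with topological embeddings. -/
abbrev Structure : Type (max (u + 1) (v + 1)) := BCM.{u} ⥤ MTop.{v}

/-! ### Metrizations -/

/-- A metrization of a functor `F` into metrizable spaces: each `F.obj X` is a non-empty space
with a metric inducing its topology, and every `F.map f` preserves distances. In other words, it is
a lift of `F` along the forgetful functor from non-empty metric spaces with isometric
embeddings. -/
structure Metrization {C : Type w} [Category.{w'} C] (F : C ⥤ MTop.{v}) where
  metric : ∀ X : C, MetricSpace (F.obj X)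
  nonempty : ∀ X : C, Nonempty (F.obj X)
  topology_eq : ∀ X : C,
    (metric X).toUniformSpace.toTopologicalSpace = (F.obj X).topologicalSpace
  dist_map : ∀ {X Y : C} (f : X ⟶ Y) (a b : F.obj X),
    (metric Y).dist (F.map f a) (F.map f b) = (metric X).dist a b

/-- All metrics of the metrization are complete. -/
def Metrization.IsComplete {C : Type w} [Category.{w'} C] {F : C ⥤ MTop.{v}}
    (S : Metrization F) : Prop :=
  ∀ X : C, @CompleteSpace (F.obj X) (S.metric X).toUniformSpace

/-- The functor `(X, ρ) ↦ τ(X)`. -/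
abbrev spaceRooted (τ : Structure.{u, v}) : RootedBCM.{u} ⥤ MTop.{v} := forgetRoot ⋙ τ

/-- The functor `X ↦ τ(X) × X`, `f ↦ τ_f × f`. -/
def elementRooted (τ : Structure.{u, v}) : BCM.{u} ⥤ MTop.{max u v} where
  obj X := ⟨τ.obj X × X⟩
  map {X Y} f := ⟨Prod.map (τ.map f).toFun f.toFun,
    (τ.map f).isEmbedding.prodMap f.isometry.isEmbedding⟩
  map_id X := by
    apply MTop.Hom.ext
    funext p
    change ((τ.map (𝟙 X)).toFun p.1, p.2) = p
    rw [τ.map_id]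
    rfl
  map_comp {X Y Z} f g := by
    apply MTop.Hom.ext
    funext p
    change ((τ.map (f ≫ g)).toFun p.1, g.toFun (f.toFun p.2)) = _
    rw [τ.map_comp]
    rfl

abbrev SpaceRootedMetrization (τ : Structure.{u, v}) := Metrization (spaceRooted τ)

abbrev ElementRootedMetrization (τ : Structure.{u, v}) := Metrization (elementRooted τ)

/-- A metrization is stable if there is a distortion function `D` such that enlarging the
distances between two embedded spaces `X`, `Y` by at most `ε` enlarges the distances between
elements of `F(X)` and `F(Y)` by at most `D ε`. -/
def Metrization.IsStable {F : BCM.{u} ⥤ MTop.{v}} (S : Metrization F) : Prop :=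
  ∃ D : NNReal → NNReal, D 0 = 0 ∧ Tendsto D (𝓝 0) (𝓝 0) ∧
    ∀ (X Y M₁ M₂ : BCM.{u}) (f₁ : X ⟶ M₁) (f₂ : X ⟶ M₂) (g₁ : Y ⟶ M₁) (g₂ : Y ⟶ M₂)
      (ε : NNReal),
      (∀ (x : X) (y : Y), dist (f₂ x) (g₂ y) ≤ dist (f₁ x) (g₁ y) + ε) →
      ∀ (a : F.obj X) (b : F.obj Y),
        (S.metric M₂).dist (F.map f₂ a) (F.map g₂ b) ≤
          (S.metric M₁).dist (F.map f₁ a) (F.map g₁ b) + D ε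

/-- A structure is stably metrizable if it admits a stable element-rooted metrization. -/
def IsStablyMetrizable (τ : Structure.{u, v}) : Prop :=
  ∃ E : ElementRootedMetrization τ, E.IsStable

/-! ### Continuity properties of structures -/

/-- Convergence of a sequence of subsets in the Fell topology, which is generated by the sets
`{A | A ∩ K = ∅}`, `K` compact, and `{A | A ∩ U ≠ ∅}`, `U` open. -/
def FellTendsto {M : Type u} [TopologicalSpace M] (A : ℕ → Set M) (B : Set M) : Prop :=
  (∀ K : Set M, IsCompact K → B ∩ K = ∅ → ∀ᶠ n in atTop, A n ∩ K = ∅) ∧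
    ∀ U : Set M, IsOpen U → (B ∩ U).Nonempty → ∀ᶠ n in atTop, (A n ∩ U).Nonempty

/-- If `fₙ → f` uniformly on compact sets then `τ_{fₙ}(a) → τ_f(a)` for every `a`. -/
def IsEmbeddingContinuous (τ : Structure.{u, v}) : Prop :=
  ∀ (X Y : BCM.{u}) (f : ℕ → (X ⟶ Y)) (g : X ⟶ Y),
    (∀ K : Set X, IsCompact K → TendstoUniformlyOn (fun n => (f n).toFun) g.toFun atTop K) →
    ∀ a : τ.obj X, Tendsto (fun n => τ.map (f n) a) atTop (𝓝 (τ.map g a))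

def IsUpperSemicontinuous (τ : Structure.{u, v}) : Prop :=
  ∀ (Y : BCM.{u}) (X : ℕ → BCM.{u}) (X' : BCM.{u}) (f : ∀ n, X n ⟶ Y) (f' : X' ⟶ Y),
    FellTendsto (fun n => Set.range (f n).toFun) (Set.range f'.toFun) →
    ∀ (a : ∀ n, τ.obj (X n)) (b : τ.obj Y),
      Tendsto (fun n => τ.map (f n) (a n)) atTop (𝓝 b) → b ∈ Set.range (τ.map f').toFun

def IsLowerSemicontinuous (τ : Structure.{u, v}) : Prop :=
  ∀ (Y : BCM.{u}) (X : ℕ → BCM.{u}) (X' : BCM.{u}) (f : ∀ n, X n ⟶ Y) (f' : X' ⟶ Y),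
    FellTendsto (fun n => Set.range (f n).toFun) (Set.range f'.toFun) →
    ∀ a : τ.obj X', ∃ φ : ℕ → ℕ, StrictMono φ ∧ ∃ b : ∀ k, τ.obj (X (φ k)),
      Tendsto (fun k => τ.map (f (φ k)) (b k)) atTop (𝓝 (τ.map f' a))

def IsContinuousStructure (τ : Structure.{u, v}) : Prop :=
  IsEmbeddingContinuous τ ∧ IsUpperSemicontinuous τ ∧ IsLowerSemicontinuous τ

def IsSeparableStructure (τ : Structure.{u, v}) : Prop :=
  ∀ X : BCM.{u}, TopologicalSpace.SeparableSpace (τ.obj X)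

/-! ### Polishness with preserved roots -/

/-- A subfunctor: a family of subspaces preserved by all morphisms. -/
structure SubfunctorMTop {C : Type w} [Category.{w'} C] (F : C ⥤ MTop.{v}) where
  carrier : ∀ X : C, Set (F.obj X)
  map_mem : ∀ {X Y : C} (f : X ⟶ Y) (a : F.obj X), a ∈ carrier X → F.map f a ∈ carrier Y

namespace SubfunctorMTop

variable {C : Type w} [Category.{w'} C] {F : C ⥤ MTop.{v}}

def IsOpenSub (σ : SubfunctorMTop F) : Prop := ∀ X : C, IsOpen (σ.carrier X)

def IsPullbackStable (σ : SubfunctorMTop F) : Prop :=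
  ∀ (X Y : C) (f : X ⟶ Y), (F.map f).toFun ⁻¹' σ.carrier Y = σ.carrier X

end SubfunctorMTop

/-- `τ` is Polish with preserved roots: there is a natural transformation `η : τ ⟶ τ'` (whose
components are topological embeddings) into a continuous separable structure `τ'` with a complete
space-rooted metrization, such that the image of `η` is a countable intersection of open
pullback-stable subfunctors of `(X, ρ) ↦ τ'(X)`. -/
def IsPolishWithPreservedRoots (τ : Structure.{u, v}) : Prop :=
  ∃ (τ' : Structure.{u, v}) (η : τ ⟶ τ') (σ : ℕ → SubfunctorMTop (spaceRooted τ')),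
    IsContinuousStructure τ' ∧ IsSeparableStructure τ' ∧
    (∃ S : SpaceRootedMetrization τ', S.IsComplete) ∧
    (∀ k, (σ k).IsPullbackStable ∧ (σ k).IsOpenSub) ∧
    ∀ X : RootedBCM.{u}, Set.range (η.app X.toBCM).toFun = ⋂ k, (σ k).carrier X

/-! ### Local Hausdorff metrics -/

/-- `∫₀^∞ e^{-r} (1 ∧ d_H(A ∩ D(x, r), B ∩ D(y, r))) dr`, where `D` denotes closed balls and `d_H`
the Hausdorff distance (infinite between the empty set and a non-empty set). -/
noncomputable def localHausdorffIntegral {Z : Type u} [MetricSpace Z]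
    (A : Set Z) (x : Z) (B : Set Z) (y : Z) : ℝ :=
  (∫⁻ r in Set.Ioi (0 : ℝ), ENNReal.ofReal (Real.exp (-r)) *
    min 1 (Metric.hausdorffEDist (A ∩ Metric.closedBall x r) (B ∩ Metric.closedBall y r))).toReal

/-- The local Hausdorff metric on closed subsets of `Z` rooted at `ρ`. -/
noncomputable def localHausdorffDist {Z : Type u} [MetricSpace Z] (ρ : Z) (A B : Set Z) : ℝ :=
  localHausdorffIntegral A ρ B ρ

/-- The local Hausdorff metric on pairs of a closed subset of `Z` and a point of `Z`. -/
noncomputable def localHausdorffProdDist {Z : Type u} [MetricSpace Z] (p q : Set Z × Z) : ℝ :=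
  max (dist p.2 q.2) (localHausdorffIntegral p.1 p.2 q.1 q.2)

/-! ### The space of rooted spaces with an element of `τ` -/

/-- A triple `(X, ρ, a)` with `(X, ρ)` a rooted boundedly compact space and `a ∈ τ(X)`. -/
structure DecoratedBCM (τ : Structure.{u, v}) : Type (max (u + 1) v) where
  space : RootedBCM.{u}
  elt : τ.obj space.toBCM

/-- Rooted-`τ`-isometry: a root-preserving bijective isometry `f` with `τ_f(a) = b`. -/
def RootedIsometric {τ : Structure.{u, v}} (P Q : DecoratedBCM τ) : Prop :=
  ∃ f : P.space ⟶ Q.space, Function.Surjective f.toHom.toFun ∧ τ.map f.toHom P.elt = Q.elt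

theorem RootedIsometric.refl {τ : Structure.{u, v}} (P : DecoratedBCM τ) :
    RootedIsometric P P := by
  refine ⟨𝟙 _, fun x => ⟨x, rfl⟩, ?_⟩
  change (τ.map (𝟙 P.space.toBCM)).toFun P.elt = P.elt
  rw [τ.map_id]
  rfl

theorem RootedIsometric.symm {τ : Structure.{u, v}} {P Q : DecoratedBCM τ}
    (h : RootedIsometric P Q) : RootedIsometric Q P := by
  obtain ⟨f, hs, hf⟩ := h
  obtain ⟨g, hg⟩ := hs.hasRightInverse
  have hgi : ∀ x, g (f.toHom.toFun x) = x := fun x => f.toHom.isometry.injective (hg _)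
  have hiso : Isometry g := fun x y => by
    rw [← f.toHom.isometry (g x) (g y), hg, hg]
  let G : Q.space.toBCM ⟶ P.space.toBCM := BCM.Hom.mk g hiso
  refine ⟨⟨G, ?_⟩, fun x => ⟨_, hgi x⟩, ?_⟩
  · change g Q.space.root = P.space.root
    rw [← f.map_root]
    exact hgi _
  · change (τ.map G).toFun Q.elt = P.elt
    rw [← hf]
    change (τ.map f.toHom ≫ τ.map G).toFun P.elt = P.elt
    have hid : f.toHom ≫ G = 𝟙 _ := BCM.Hom.ext (funext hgi)
    rw [← τ.map_comp, hid, τ.map_id]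
    rfl

theorem RootedIsometric.trans {τ : Structure.{u, v}} {P Q R : DecoratedBCM τ}
    (h : RootedIsometric P Q) (h' : RootedIsometric Q R) : RootedIsometric P R := by
  obtain ⟨f, hs, hf⟩ := h
  obtain ⟨g, hs', hg⟩ := h'
  refine ⟨f ≫ g, hs'.comp hs, ?_⟩
  change (τ.map (f.toHom ≫ g.toHom)).toFun P.elt = R.elt
  rw [τ.map_comp, ← hg, ← hf]
  rfl

instance decoratedSetoid (τ : Structure.{u, v}) : Setoid (DecoratedBCM τ) where
  r := RootedIsometric
  iseqv := ⟨RootedIsometric.refl, RootedIsometric.symm, RootedIsometric.trans⟩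

/-- The set of rooted boundedly compact spaces equipped with an element of `τ`, up to
rooted-`τ`-isometry. -/
def RootedSpaces (τ : Structure.{u, v}) : Type (max (u + 1) v) := Quotient (decoratedSetoid τ)

/-! ### The two local Gromov-Hausdorff-type metrics -/

/-- The values over which the infimum defining the metric with preserved roots is taken. -/
def preservedValues {τ : Structure.{u, v}} (S : SpaceRootedMetrization τ)
    (P Q : DecoratedBCM τ) : Set ℝ :=
  {r | ∃ (Z : RootedBCM.{u}) (f : P.space ⟶ Z) (g : Q.space ⟶ Z),
    r = max (localHausdorffDist Z.root (Set.range f.toHom.toFun) (Set.range g.toHom.toFun))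
      ((S.metric Z).dist (τ.map f.toHom P.elt) (τ.map g.toHom Q.elt))}

/-- The values over which the infimum defining the metric with non-preserved roots is taken. -/
def nonPreservedValues {τ : Structure.{u, v}} (E : ElementRootedMetrization τ)
    (P Q : DecoratedBCM τ) : Set ℝ :=
  {r | ∃ (Z : BCM.{u}) (f : P.space.toBCM ⟶ Z) (g : Q.space.toBCM ⟶ Z),
    r = max
      (localHausdorffProdDist (Set.range f.toFun, f P.space.root)
        (Set.range g.toFun, g Q.space.root))
      ((E.metric Z).dist (τ.map f P.elt, f P.space.root) (τ.map g Q.elt, g Q.space.root))}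

theorem preservedValues_subset {τ : Structure.{u, v}} (S : SpaceRootedMetrization τ)
    {P Q P' Q' : DecoratedBCM τ} (hP : RootedIsometric P P') (hQ : RootedIsometric Q Q') :
    preservedValues S P' Q' ⊆ preservedValues S P Q := by
  rintro r ⟨Z, f, g, rfl⟩
  obtain ⟨e, hes, he⟩ := hP
  obtain ⟨e', hes', he'⟩ := hQ
  refine ⟨Z, e ≫ f, e' ≫ g, ?_⟩
  have h1 : Set.range (e ≫ f).toHom.toFun = Set.range f.toHom.toFun := hes.range_comp _
  have h2 : Set.range (e' ≫ g).toHom.toFun = Set.range g.toHom.toFun := hes'.range_comp _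
  have h3 : (τ.map (e ≫ f).toHom).toFun P.elt = (τ.map f.toHom).toFun P'.elt := by
    change (τ.map (e.toHom ≫ f.toHom)).toFun P.elt = _
    rw [τ.map_comp, ← he]
    rfl
  have h4 : (τ.map (e' ≫ g).toHom).toFun Q.elt = (τ.map g.toHom).toFun Q'.elt := by
    change (τ.map (e'.toHom ≫ g.toHom)).toFun Q.elt = _
    rw [τ.map_comp, ← he']
    rfl
  rw [h1, h2, h3, h4]

theorem nonPreservedValues_subset {τ : Structure.{u, v}} (E : ElementRootedMetrization τ)
    {P Q P' Q' : DecoratedBCM τ} (hP : RootedIsometric P P') (hQ : RootedIsometric Q Q') :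
    nonPreservedValues E P' Q' ⊆ nonPreservedValues E P Q := by
  rintro r ⟨Z, f, g, rfl⟩
  obtain ⟨e, hes, he⟩ := hP
  obtain ⟨e', hes', he'⟩ := hQ
  refine ⟨Z, e.toHom ≫ f, e'.toHom ≫ g, ?_⟩
  have h1 : Set.range (e.toHom ≫ f).toFun = Set.range f.toFun := hes.range_comp _
  have h2 : Set.range (e'.toHom ≫ g).toFun = Set.range g.toFun := hes'.range_comp _
  have h3 : (τ.map (e.toHom ≫ f)).toFun P.elt = (τ.map f).toFun P'.elt := by
    rw [τ.map_comp, ← he]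
    rfl
  have h4 : (τ.map (e'.toHom ≫ g)).toFun Q.elt = (τ.map g).toFun Q'.elt := by
    rw [τ.map_comp, ← he']
    rfl
  have h5 : (e.toHom ≫ f).toFun P.space.root = f.toFun P'.space.root :=
    congrArg f.toFun e.map_root
  have h6 : (e'.toHom ≫ g).toFun Q.space.root = g.toFun Q'.space.root :=
    congrArg g.toFun e'.map_root
  rw [h1, h2, h3, h4, h5, h6]

/-- The local Gromov-Hausdorff-type metric with preserved roots: the infimum, over all rooted
boundedly compact spaces `(Z, ρ)` and root-preserving isometric embeddings `f`, `g` into it, of the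
maximum of the local Hausdorff distance at `ρ` of the images and the distance of `τ_f(a)` and
`τ_g(b)` in `τ(Z)` rooted at `ρ`. -/
noncomputable def preservedDist {τ : Structure.{u, v}} (S : SpaceRootedMetrization τ) :
    RootedSpaces τ → RootedSpaces τ → ℝ :=
  Quotient.lift₂ (fun P Q => sInf (preservedValues S P Q)) fun _ _ _ _ h h' =>
    congrArg sInf (Set.Subset.antisymm
      (preservedValues_subset S (RootedIsometric.symm h) (RootedIsometric.symm h'))
      (preservedValues_subset S h h'))

/-- The local Gromov-Hausdorff-type metric with non-preserved roots: the infimum, over all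
boundedly compact spaces `Z` and isometric embeddings `f`, `g` into it, of the maximum of the local
Hausdorff distance of the images paired with the images of the roots and the distance of
`(τ_f(a), f(ρ_X))` and `(τ_g(b), g(ρ_Y))` in `τ(Z) × Z`. -/
noncomputable def nonPreservedDist {τ : Structure.{u, v}} (E : ElementRootedMetrization τ) :
    RootedSpaces τ → RootedSpaces τ → ℝ :=
  Quotient.lift₂ (fun P Q => sInf (nonPreservedValues E P Q)) fun _ _ _ _ h h' =>
    congrArg sInf (Set.Subset.antisymm
      (nonPreservedValues_subset E (RootedIsometric.symm h) (RootedIsometric.symm h'))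
      (nonPreservedValues_subset E h h'))

/-! ### Local Hausdorff convergence -/

section LocalHausdorff

variable {Z : Type u} [MetricSpace Z]

/-! The infima defining the two distances run over varying ambient spaces, so the first task is to
reduce them to convergence in one fixed space. If the distance of `Pₙ` to `Q` tends to zero, nearly
optimal embeddings are chosen and all the spaces are glued along `Q` (`BCM.exists_starGlue`); the
local Hausdorff convergence keeps the result boundedly compact. A metrization sees only the cross
distances between two embedded spaces (`Metrization.dist_eq_of_cross`), so gluing alters no value.
Conversely, a common space competes in every infimum, and dominated convergence controls the
integral. Convergence in either distance thus becomes `TendstoPreserved` or `TendstoNonPreserved`,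
in which no metrization occurs.

The triangle inequality comes from gluing along the middle space. Distance zero gives a constant
sequence `P` converging to `Q`; a limit of its embeddings, found by Arzelà–Ascoli, has the same
image as `Q` and carries one element to the other.

Preserved convergence trivially implies non-preserved convergence. For the converse,
`BCM.exists_merge` makes the roots coincide while changing cross distances by at most the distance
`εₙ` of the roots, and stability bounds the effect on elements by `D εₙ → 0`. Both topologies being
metrizable, they agree.

For Polishness, consider first the continuous separable structure `τ'` with a complete metrization.
A fast Cauchy sequence is glued into a chain with boundedly compact completion; the elements
converge there, and upper semicontinuity puts the limit on the limit set
(`exists_tendstoPreserved`). Lower semicontinuity gives density of a countable family of finite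
spaces (`separableSpace_preservedMetric`). Finally `η` induces an embedding into this Polish space
whose range is a countable intersection of open sets. -/

/-- The bounded closed parts of `A` are compact. -/
def BoundedlyCompact (A : Set Z) : Prop := ∀ x r, IsCompact (A ∩ Metric.closedBall x r)

/-- Compactness is asked of the sets and not of the ambient space, because the local Hausdorff
integral is needed in glued spaces before these are known to be proper. -/
theorem boundedlyCompact_range {X : Type w} [MetricSpace X] [ProperSpace X] {f : X → Z}
    (hf : Isometry f) : BoundedlyCompact (Set.range f) := by
  intro x r
  have h : Set.range f ∩ Metric.closedBall x r = f '' (f ⁻¹' Metric.closedBall x r) := by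
    rw [Set.image_preimage_eq_inter_range, Set.inter_comm]
  rw [h]
  refine (Metric.isCompact_of_isClosed_isBounded
    (Metric.isClosed_closedBall.preimage hf.continuous) ?_).image hf.continuous
  rw [Metric.isBounded_iff]
  refine ⟨r + r, fun a ha b hb => ?_⟩
  rw [← hf.dist_eq]
  exact (dist_triangle_right _ _ x).trans (add_le_add ha hb)

theorem BoundedlyCompact.isClosed {A : Set Z} (hA : BoundedlyCompact A) : IsClosed A := by
  refine isClosed_of_closure_subset fun z hz => ?_
  have h : z ∈ closure (A ∩ Metric.closedBall z 1) := by
    rw [Metric.mem_closure_iff] at hz ⊢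
    intro ε hε
    obtain ⟨b, hb, hd⟩ := hz (min ε 1) (lt_min hε one_pos)
    refine ⟨b, ⟨hb, ?_⟩, hd.trans_le (min_le_left _ _)⟩
    rw [Metric.mem_closedBall, dist_comm]
    exact hd.le.trans (min_le_right _ _)
  exact ((hA z 1).isClosed.closure_subset h).1

/-- The part of `A` at distance at most `r` from `x`. -/
def BoundedlyCompact.ball {A : Set Z} (hA : BoundedlyCompact A) (x : Z) (r : ℝ) :
    TopologicalSpace.Compacts Z := ⟨A ∩ Metric.closedBall x r, hA x r⟩

/-- The points of `A` within `r + 1` of `x` that keep away from the part of radius `r` form a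
compact set. If it is non-empty, its least distance to `x` is attained and exceeds `r`, which leaves
room for `s`. -/
theorem BoundedlyCompact.exists_ball_subset {A : Set Z} (hA : BoundedlyCompact A) (x : Z) (r : ℝ)
    {ε : ℝ} (hε : 0 < ε) :
    ∃ s > r, ∀ a ∈ A, dist a x ≤ s → ∃ b ∈ A, dist b x ≤ r ∧ dist a b < ε := by
  set K : Set Z := (A ∩ Metric.closedBall x (r + 1)) \ Metric.thickening ε
    (A ∩ Metric.closedBall x r) with hK
  have hKc : IsCompact K := (hA x (r + 1)).diff Metric.isOpen_thickening
  have key : ∃ s > r, s ≤ r + 1 ∧ ∀ a ∈ K, s < dist a x := by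
    rcases K.eq_empty_or_nonempty with h | h
    · exact ⟨r + 1, by linarith, le_rfl, by simp [h]⟩
    · obtain ⟨a, ha, hmin⟩ := hKc.exists_isMinOn h
        (continuous_id.dist continuous_const : Continuous fun a => dist a x).continuousOn
      have har : r < dist a x := by
        by_contra hle
        exact ha.2 (Metric.self_subset_thickening hε _ ⟨ha.1.1, not_lt.1 hle⟩)
      have har1 : dist a x ≤ r + 1 := ha.1.2
      refine ⟨(r + dist a x) / 2, by linarith, by linarith, fun b hb => ?_⟩
      have : dist a x ≤ dist b x := hmin hb
      linarith
  obtain ⟨s, hs, hs1, hsK⟩ := key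
  refine ⟨s, hs, fun a ha has => ?_⟩
  by_contra hcon
  refine (hsK a ⟨⟨ha, Metric.mem_closedBall.2 (by linarith)⟩, fun hth => hcon ?_⟩).not_ge has
  obtain ⟨b, hb, hab⟩ := Metric.mem_thickening_iff.1 hth
  exact ⟨b, hb.1, hb.2, hab⟩

/-- Right-continuity in the radius. Left-continuity may fail when `A` has points on the sphere of
radius `r`. -/
theorem BoundedlyCompact.tendsto_ball {A : Set Z} (hA : BoundedlyCompact A) (x : Z) (r : ℝ)
    {s : ℕ → ℝ} (hs : Tendsto s atTop (𝓝[≥] r)) :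
    Tendsto (fun n => hA.ball x (s n)) atTop (𝓝 (hA.ball x r)) := by
  rw [EMetric.tendsto_nhds]
  intro ε hε
  obtain ⟨δ, hδ, hδε⟩ := ENNReal.lt_iff_exists_nnreal_btwn.1 hε
  have hδ0 : (0 : ℝ) < δ := by exact_mod_cast hδ
  obtain ⟨t, ht, hball⟩ := hA.exists_ball_subset x r hδ0
  have h1 : ∀ᶠ n in atTop, s n ∈ Set.Ico r t := hs (Ico_mem_nhdsGE ht)
  filter_upwards [h1] with n hn
  refine lt_of_le_of_lt ?_ hδε
  rw [TopologicalSpace.Compacts.edist_eq]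
  refine Metric.hausdorffEDist_le_of_mem_edist ?_ ?_
  · rintro a ⟨ha, has⟩
    obtain ⟨b, hb, hbr, hab⟩ := hball a ha (le_trans has hn.2.le)
    refine ⟨b, ⟨hb, hbr⟩, ?_⟩
    rw [edist_nndist]
    exact_mod_cast hab.le
  · rintro a ⟨ha, har⟩
    exact ⟨a, ⟨ha, le_trans (Metric.mem_closedBall.1 har) hn.1⟩, by simp⟩

/-- A right-continuous function is the pointwise limit of step functions that sample it on ever
finer grids. -/
theorem measurable_hausdorffEDist_ball {A B : Set Z} (hA : BoundedlyCompact A)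
    (hB : BoundedlyCompact B) (x y : Z) :
    Measurable fun r : ℝ => Metric.hausdorffEDist (A ∩ Metric.closedBall x r)
      (B ∩ Metric.closedBall y r) := by
  let F : ℝ → ENNReal := fun r => edist (hA.ball x r) (hB.ball y r)
  change Measurable F
  -- The first point of the grid of mesh `1 / (n + 1)` strictly to the right of `r`; it factors
  -- through an integer, hence the measurability.
  let s : ℕ → ℝ → ℝ := fun n r => (⌊(n + 1 : ℝ) * r⌋ + 1 : ℝ) / (n + 1 : ℝ)
  have hs : ∀ n, Measurable fun r => F (s n r) := fun n => by
    have h1 : Measurable fun r : ℝ => ⌊(n + 1 : ℝ) * r⌋ :=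
      Int.measurable_floor.comp (measurable_const_mul _)
    have h2 : Measurable fun k : ℤ => F ((k + 1 : ℝ) / (n + 1 : ℝ)) := measurable_from_top
    exact h2.comp h1
  refine measurable_of_tendsto_metrizable hs (tendsto_pi_nhds.2 fun r => ?_)
  have hsr : Tendsto (fun n => s n r) atTop (𝓝[≥] r) := by
    refine tendsto_nhdsWithin_iff.2 ⟨?_, Eventually.of_forall fun n => ?_⟩
    · have hlim : Tendsto (fun n : ℕ => r + 1 / ((n : ℝ) + 1)) atTop (𝓝 (r + 0)) :=
        tendsto_const_nhds.add tendsto_one_div_add_atTop_nhds_zero_nat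
      rw [add_zero] at hlim
      refine tendsto_of_tendsto_of_tendsto_of_le_of_le tendsto_const_nhds hlim
        (fun n => ?_) (fun n => ?_)
      · have hn : (0 : ℝ) < n + 1 := by positivity
        simp only [s]
        rw [le_div_iff₀ hn]
        nlinarith [Int.lt_floor_add_one ((n + 1 : ℝ) * r)]
      · have hn : (0 : ℝ) < n + 1 := by positivity
        simp only [s]
        have h : (r + 1 / (n + 1 : ℝ)) * (n + 1 : ℝ) = (n + 1 : ℝ) * r + 1 := by field_simp
        rw [div_le_iff₀ hn, h]
        linarith [Int.floor_le ((n + 1 : ℝ) * r)]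
    · have hn : (0 : ℝ) < n + 1 := by positivity
      simp only [s, Set.mem_Ici]
      rw [le_div_iff₀ hn]
      nlinarith [Int.lt_floor_add_one ((n + 1 : ℝ) * r)]
  exact (hA.tendsto_ball x r hsr).edist (hB.tendsto_ball y r hsr)

/-- The integrand of the local Hausdorff metric. -/
noncomputable def localHausdorffIntegrand (A : Set Z) (x : Z) (B : Set Z) (y : Z) (r : ℝ) :
    ENNReal :=
  ENNReal.ofReal (Real.exp (-r)) *
    min 1 (Metric.hausdorffEDist (A ∩ Metric.closedBall x r) (B ∩ Metric.closedBall y r))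

theorem measurable_localHausdorffIntegrand {A B : Set Z} (hA : BoundedlyCompact A)
    (hB : BoundedlyCompact B) (x y : Z) : Measurable (localHausdorffIntegrand A x B y) :=
  (ENNReal.measurable_ofReal.comp (Real.measurable_exp.comp measurable_neg)).mul
    (measurable_const.min (measurable_hausdorffEDist_ball hA hB x y))

theorem localHausdorffIntegrand_le (A : Set Z) (x : Z) (B : Set Z) (y : Z) (r : ℝ) :
    localHausdorffIntegrand A x B y r ≤ ENNReal.ofReal (Real.exp (-r)) :=
  mul_le_of_le_one_right' (min_le_left _ _)

theorem lintegral_exp_neg_ne_top :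
    ∫⁻ r in Set.Ioi (0 : ℝ), ENNReal.ofReal (Real.exp (-r)) ≠ ⊤ :=
  (integrableOn_exp_neg_Ioi 0).lintegral_lt_top.ne

theorem lintegral_localHausdorffIntegrand_ne_top (A : Set Z) (x : Z) (B : Set Z) (y : Z) :
    ∫⁻ r in Set.Ioi (0 : ℝ), localHausdorffIntegrand A x B y r ≠ ⊤ :=
  ne_top_of_le_ne_top lintegral_exp_neg_ne_top
    (MeasureTheory.lintegral_mono fun r => localHausdorffIntegrand_le A x B y r)

theorem localHausdorffIntegral_eq (A : Set Z) (x : Z) (B : Set Z) (y : Z) :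
    localHausdorffIntegral A x B y =
      (∫⁻ r in Set.Ioi (0 : ℝ), localHausdorffIntegrand A x B y r).toReal := rfl

theorem localHausdorffIntegral_nonneg (A : Set Z) (x : Z) (B : Set Z) (y : Z) :
    0 ≤ localHausdorffIntegral A x B y := ENNReal.toReal_nonneg

theorem localHausdorffIntegral_self (A : Set Z) (x : Z) :
    localHausdorffIntegral A x A x = 0 := by
  simp [localHausdorffIntegral]

theorem localHausdorffIntegral_comm (A : Set Z) (x : Z) (B : Set Z) (y : Z) :
    localHausdorffIntegral A x B y = localHausdorffIntegral B y A x := by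
  simp only [localHausdorffIntegral, Metric.hausdorffEDist_comm]

theorem localHausdorffIntegral_triangle {A B C : Set Z} (hA : BoundedlyCompact A)
    (hB : BoundedlyCompact B) (x y z : Z) :
    localHausdorffIntegral A x C z ≤
      localHausdorffIntegral A x B y + localHausdorffIntegral B y C z := by
  simp only [localHausdorffIntegral_eq]
  rw [← ENNReal.toReal_add (lintegral_localHausdorffIntegrand_ne_top _ _ _ _)
    (lintegral_localHausdorffIntegrand_ne_top _ _ _ _)]
  refine ENNReal.toReal_mono (ENNReal.add_ne_top.2
    ⟨lintegral_localHausdorffIntegrand_ne_top _ _ _ _,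
      lintegral_localHausdorffIntegrand_ne_top _ _ _ _⟩) ?_
  rw [← MeasureTheory.lintegral_add_left (measurable_localHausdorffIntegrand hA hB x y)]
  refine MeasureTheory.lintegral_mono fun r => ?_
  simp only [localHausdorffIntegrand]
  rw [← mul_add]
  refine mul_le_mul_right ?_ _
  set a := Metric.hausdorffEDist (A ∩ Metric.closedBall x r) (B ∩ Metric.closedBall y r)
  set b := Metric.hausdorffEDist (B ∩ Metric.closedBall y r) (C ∩ Metric.closedBall z r)
  have h : Metric.hausdorffEDist (A ∩ Metric.closedBall x r) (C ∩ Metric.closedBall z r) ≤ a + b :=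
    Metric.hausdorffEDist_triangle
  -- Truncation at `1` respects the triangle inequality: if one summand is truncated, the right side
  -- is already at least `1`.
  rcases le_total 1 a with ha | ha
  · exact (min_le_left _ _).trans (by rw [min_eq_left ha]; exact le_self_add)
  rcases le_total 1 b with hb | hb
  · exact (min_le_left _ _).trans (by rw [min_eq_left hb]; exact le_add_self)
  rw [min_eq_right ha, min_eq_right hb]
  exact (min_le_right _ _).trans h

theorem localHausdorffIntegral_image {Z' : Type w} [MetricSpace Z'] {φ : Z → Z'} (hφ : Isometry φ)
    (A : Set Z) (x : Z) (B : Set Z) (y : Z) :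
    localHausdorffIntegral (φ '' A) (φ x) (φ '' B) (φ y) = localHausdorffIntegral A x B y := by
  have h : ∀ (C : Set Z) (z : Z) (r : ℝ),
      φ '' C ∩ Metric.closedBall (φ z) r = φ '' (C ∩ Metric.closedBall z r) := fun C z r => by
    rw [← Set.image_inter_preimage, hφ.preimage_closedBall]
  simp only [localHausdorffIntegral, h, Metric.hausdorffEDist_image hφ]

/-- Every point of `A` at distance at most `R` from `x` is at distance less than `ε` from `B`. -/
def NearOn (x : Z) (R ε : ℝ) (A B : Set Z) : Prop :=
  ∀ a ∈ A, dist a x ≤ R → ∃ b ∈ B, dist a b < ε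

theorem NearOn.mono {x : Z} {R R' ε ε' : ℝ} {A B : Set Z} (h : NearOn x R ε A B) (hR : R' ≤ R)
    (hε : ε ≤ ε') : NearOn x R' ε' A B := fun a ha hax =>
  let ⟨b, hb, hab⟩ := h a ha (hax.trans hR)
  ⟨b, hb, hab.trans_le hε⟩

/-- Local Hausdorff convergence of sets. -/
def LocallyTendsto (x : Z) (A : ℕ → Set Z) (B : Set Z) : Prop :=
  ∀ R ε : ℝ, 0 < ε → ∀ᶠ n in atTop, NearOn x R ε (A n) B ∧ NearOn x R ε B (A n)

/-- If the Hausdorff distance were at least `ε` at all radii in `(R, R + 1)`, this unit interval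
alone would contribute `ε * exp (-(R + 1))`; the truncation does not interfere since `ε ≤ 1`. One
good radius above `R` is enough. -/
theorem nearOn_of_localHausdorffIntegral_lt {A B : Set Z} {x y : Z} {R ε : ℝ} (hR : 0 ≤ R)
    (hε : 0 < ε) (hε1 : ε ≤ 1)
    (h : localHausdorffIntegral A x B y < ε * Real.exp (-(R + 1))) : NearOn x R ε A B := by
  have key : ∃ r ∈ Set.Ioo R (R + 1), Metric.hausdorffEDist (A ∩ Metric.closedBall x r)
      (B ∩ Metric.closedBall y r) < ENNReal.ofReal ε := by
    by_contra hcon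
    push Not at hcon
    refine h.not_ge ?_
    rw [localHausdorffIntegral_eq]
    refine (ENNReal.ofReal_le_iff_le_toReal
      (lintegral_localHausdorffIntegrand_ne_top _ _ _ _)).1 ?_
    calc ENNReal.ofReal (ε * Real.exp (-(R + 1)))
        = ∫⁻ r in Set.Ioo R (R + 1), ENNReal.ofReal (ε * Real.exp (-(R + 1))) := by
          rw [MeasureTheory.setLIntegral_const, Real.volume_Ioo]; simp
      _ ≤ ∫⁻ r in Set.Ioo R (R + 1), localHausdorffIntegrand A x B y r := by
          refine MeasureTheory.setLIntegral_mono' measurableSet_Ioo fun r hr => ?_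
          rw [mul_comm, ENNReal.ofReal_mul (Real.exp_pos _).le]
          refine mul_le_mul' (ENNReal.ofReal_le_ofReal (Real.exp_le_exp.2 (by linarith [hr.2])))
            (le_min ?_ (hcon r hr))
          exact ENNReal.ofReal_le_one.2 hε1
      _ ≤ ∫⁻ r in Set.Ioi 0, localHausdorffIntegrand A x B y r :=
          MeasureTheory.lintegral_mono_set fun r hr => lt_of_le_of_lt hR hr.1
  obtain ⟨r, hr, hd⟩ := key
  intro a ha hax
  obtain ⟨b, hb, hab⟩ := Metric.exists_edist_lt_of_hausdorffEDist_lt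
    (show a ∈ A ∩ Metric.closedBall x r from ⟨ha, hax.trans hr.1.le⟩) hd
  refine ⟨b, hb.1, ?_⟩
  rwa [edist_dist, ENNReal.ofReal_lt_ofReal_iff hε] at hab

/-- The radii at which `r ↦ B ∩ closedBall y r` fails to be left-continuous form a countable set. -/
theorem countable_setOf_not_mem_closure_ball [SecondCountableTopology Z] (B : Set Z) (y : Z) :
    {r | ∃ b ∈ B, dist b y = r ∧ b ∉ closure (B ∩ Metric.ball y r)}.Countable := by
  -- A basic open set that meets `B` on the sphere of radius `r` but not inside it determines `r`,
  -- as the least distance from `y` to its points in `B`. Distinct radii therefore use distinct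
  -- basic sets.
  have hU : ∀ r : {r | ∃ b ∈ B, dist b y = r ∧ b ∉ closure (B ∩ Metric.ball y r)},
      ∃ U : TopologicalSpace.countableBasis Z, (∃ b ∈ B, dist b y = r ∧ b ∈ U.1) ∧
        Disjoint U.1 (B ∩ Metric.ball y r) := by
    rintro ⟨r, b, hb, hbr, hbc⟩
    obtain ⟨U, hU, hbU, hUs⟩ := (TopologicalSpace.isBasis_countableBasis Z).exists_subset_of_mem_open
      (show b ∈ (closure (B ∩ Metric.ball y r))ᶜ from hbc) isClosed_closure.isOpen_compl
    exact ⟨⟨U, hU⟩, ⟨b, hb, hbr, hbU⟩,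
      Set.disjoint_left.2 fun z hz hz' => hUs hz (subset_closure hz')⟩
  choose U hU hUd using hU
  have hle : ∀ r s, U r = U s → s.1 ≤ r.1 := fun r s h => by
    by_contra hlt
    obtain ⟨b, hb, hbr, hbU⟩ := hU r
    refine Set.disjoint_left.1 (hUd s) (h ▸ hbU) ⟨hb, ?_⟩
    rw [Metric.mem_ball, hbr]
    exact not_le.1 hlt
  have hinj : Function.Injective U := fun r s h =>
    Subtype.ext (le_antisymm (hle s r h.symm) (hle r s h))
  have := (TopologicalSpace.countable_countableBasis Z).to_subtype
  exact Set.countable_coe_iff.1 hinj.countable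

/-- Points of `A n` in the ball may be close only to points of `B` slightly outside;
right-continuity absorbs this. Points of `B` on the sphere are first replaced by points strictly
inside, which leaves room for the motion of the centre. -/
theorem LocallyTendsto.tendsto_hausdorffEDist {A : ℕ → Set Z} {B : Set Z} {x : ℕ → Z} {y : Z}
    (h : LocallyTendsto y A B) (hx : Tendsto x atTop (𝓝 y)) (hB : BoundedlyCompact B) {r : ℝ}
    (hr : ∀ b ∈ B, dist b y = r → b ∈ closure (B ∩ Metric.ball y r)) :
    Tendsto (fun n => Metric.hausdorffEDist (A n ∩ Metric.closedBall (x n) r)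
      (B ∩ Metric.closedBall y r)) atTop (𝓝 0) := by
  rw [ENNReal.tendsto_nhds_zero]
  intro ε' hε'
  obtain ⟨ε, hε0, hε⟩ := ENNReal.lt_iff_exists_nnreal_btwn.1 hε'
  replace hε0 : (0 : ℝ) < ε := by exact_mod_cast hε0
  have hxd : ∀ δ > 0, ∀ᶠ n in atTop, dist (x n) y < δ := Metric.tendsto_nhds.1 hx
  obtain ⟨s, hs, hball⟩ := hB.exists_ball_subset y r (half_pos hε0)
  have h1 : ∀ᶠ n in atTop, ∀ a ∈ A n, dist a (x n) ≤ r →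
      ∃ b ∈ B, dist b y ≤ r ∧ dist a b < ε := by
    filter_upwards [h (r + 1) (min (ε / 2) ((s - r) / 2))
      (lt_min (half_pos hε0) (half_pos (sub_pos.2 hs))), hxd (min 1 ((s - r) / 2))
      (lt_min one_pos (half_pos (sub_pos.2 hs)))] with n hn hxn a ha hax
    rw [lt_min_iff] at hxn
    obtain ⟨b, hb, hab⟩ := hn.1 a ha (by linarith [dist_triangle a (x n) y])
    rw [lt_min_iff] at hab
    obtain ⟨c, hc, hcr, hbc⟩ := hball b hb (by
      linarith [dist_triangle4 b a (x n) y, dist_comm a b])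
    exact ⟨c, hc, hcr, by linarith [dist_triangle a b c]⟩
  have h2 : ∀ᶠ n in atTop, ∀ b ∈ B ∩ Metric.closedBall y r,
      ∃ a ∈ A n, dist a (x n) ≤ r ∧ dist b a < ε := by
    refine (hB y r).induction_on (p := fun s => ∀ᶠ n in atTop, ∀ b ∈ s,
      ∃ a ∈ A n, dist a (x n) ≤ r ∧ dist b a < ε) (by simp)
      (fun s t hst ht => ht.mono fun n hn b hb => hn b (hst hb))
      (fun s t hs ht => ?_) (fun b hb => ?_)
    · filter_upwards [hs, ht] with n hn hn' b hb
      exact hb.elim (hn b) (hn' b)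
    · have hb' : b ∈ closure (B ∩ Metric.ball y r) := by
        rcases (Metric.mem_closedBall.1 hb.2).lt_or_eq with hlt | heq
        · exact subset_closure ⟨hb.1, hlt⟩
        · exact hr b hb.1 heq
      -- Half of the slack `r - dist c y` pays for passing from `c` to `A n`, the other half for
      -- passing from `y` to `x n`.
      obtain ⟨c, ⟨hcB, hcy⟩, hbc⟩ := Metric.mem_closure_iff.1 hb' (ε / 3) (by positivity)
      rw [Metric.mem_ball] at hcy
      refine ⟨Metric.ball b (ε / 3),
        mem_nhdsWithin_of_mem_nhds (Metric.ball_mem_nhds b (by positivity)), ?_⟩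
      filter_upwards [h r (min (ε / 3) ((r - dist c y) / 2))
        (lt_min (by positivity) (half_pos (sub_pos.2 hcy))),
        hxd _ (half_pos (sub_pos.2 hcy))] with n hn hxn d hd
      obtain ⟨a, ha, hca⟩ := hn.2 c hcB hcy.le
      rw [lt_min_iff] at hca
      rw [Metric.mem_ball] at hd
      exact ⟨a, ha, by linarith [dist_triangle4 a c y (x n), dist_comm a c, dist_comm (x n) y],
        by linarith [dist_triangle4 d b c a]⟩
  filter_upwards [h1, h2] with n hn hn'
  refine (Metric.hausdorffEDist_le_of_mem_edist (r := ε) ?_ ?_).trans hε.le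
  · rintro a ⟨ha, hax⟩
    obtain ⟨b, hb, hbr, hab⟩ := hn a ha hax
    exact ⟨b, ⟨hb, hbr⟩, by rw [edist_nndist]; exact_mod_cast hab.le⟩
  · intro b hb
    obtain ⟨a, ha, hax, hab⟩ := hn' b hb
    exact ⟨a, ⟨ha, hax⟩, by rw [edist_nndist]; exact_mod_cast hab.le⟩

/-- Dominated convergence with majorant `exp (-r)`; the radii without pointwise convergence are
countable, hence null. -/
theorem LocallyTendsto.tendsto_localHausdorffIntegral [SecondCountableTopology Z] {A : ℕ → Set Z}
    {B : Set Z} {x : ℕ → Z} {y : Z} (h : LocallyTendsto y A B) (hx : Tendsto x atTop (𝓝 y))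
    (hA : ∀ n, BoundedlyCompact (A n)) (hB : BoundedlyCompact B) :
    Tendsto (fun n => localHausdorffIntegral (A n) (x n) B y) atTop (𝓝 0) := by
  have key : Tendsto (fun n => ∫⁻ r in Set.Ioi (0 : ℝ),
      localHausdorffIntegrand (A n) (x n) B y r) atTop (𝓝 (∫⁻ r in Set.Ioi (0 : ℝ), 0)) := by
    refine MeasureTheory.tendsto_lintegral_of_dominated_convergence _
      (fun n => measurable_localHausdorffIntegrand (hA n) hB _ _)
      (fun n => Eventually.of_forall fun r => localHausdorffIntegrand_le _ _ _ _ r)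
      lintegral_exp_neg_ne_top ?_
    refine MeasureTheory.ae_restrict_of_ae ?_
    filter_upwards [(countable_setOf_not_mem_closure_ball B y).ae_notMem MeasureTheory.volume]
      with r hr
    have h0 := h.tendsto_hausdorffEDist hx hB (r := r) fun b hb hbr => by
      by_contra hcon
      exact hr ⟨b, hb, hbr, hcon⟩
    have h1 := ENNReal.Tendsto.const_mul (a := ENNReal.ofReal (Real.exp (-r)))
      ((tendsto_const_nhds (x := (1 : ENNReal))).min h0) (Or.inr ENNReal.ofReal_ne_top)
    simpa [localHausdorffIntegrand] using h1
  rw [MeasureTheory.lintegral_zero] at key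
  simpa [localHausdorffIntegral_eq, Function.comp_def] using
    (ENNReal.tendsto_toReal ENNReal.zero_ne_top).comp key

/-- Connects the metric notion with the semicontinuity axioms. A compact set and a closed set that
are disjoint have disjoint thickenings, which settles the condition on compact sets. -/
theorem LocallyTendsto.fellTendsto {A : ℕ → Set Z} {B : Set Z} {x : Z}
    (h : LocallyTendsto x A B) (hB : IsClosed B) : FellTendsto A B := by
  constructor
  · intro K hK hBK
    obtain ⟨δ, hδ, hd⟩ := (Set.disjoint_iff_inter_eq_empty.2 hBK).symm.exists_cthickenings hK hB
    obtain ⟨R, hR⟩ := hK.isBounded.subset_closedBall x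
    filter_upwards [h R δ hδ] with n hn
    rw [Set.eq_empty_iff_forall_notMem]
    rintro a ⟨haA, haK⟩
    obtain ⟨b, hb, hab⟩ := hn.1 a haA (hR haK)
    exact Set.disjoint_left.1 hd (Metric.mem_cthickening_of_dist_le a a δ K haK (by simp [hδ.le]))
      (Metric.mem_cthickening_of_dist_le a b δ B hb hab.le)
  · rintro U hU ⟨b, hb, hbU⟩
    obtain ⟨ε, hε, hball⟩ := Metric.isOpen_iff.1 hU b hbU
    filter_upwards [h (dist b x) ε hε] with n hn
    obtain ⟨a, ha, hab⟩ := hn.2 b hb le_rfl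
    exact ⟨a, ha, hball (by rwa [Metric.mem_ball, dist_comm])⟩

end LocalHausdorff

/-! ### Gluing boundedly compact spaces -/

section Proper

theorem properSpace_of_forall_isCompact {Z : Type u} [MetricSpace Z] (z : Z)
    (h : ∀ r, IsCompact (Metric.closedBall z r)) : ProperSpace Z :=
  ⟨fun x r => (h (r + dist x z)).of_isClosed_subset Metric.isClosed_closedBall
    (Metric.closedBall_subset_closedBall' le_rfl)⟩

theorem properSpace_of_range_union {X : Type v} {Y : Type w} {Z : Type u} [MetricSpace X]
    [ProperSpace X] [MetricSpace Y] [ProperSpace Y] [MetricSpace Z] {f : X → Z} {g : Y → Z}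
    (hf : Isometry f) (hg : Isometry g) (h : ∀ z, z ∈ Set.range f ∪ Set.range g) :
    ProperSpace Z := by
  refine ⟨fun z r => ?_⟩
  have hz : Metric.closedBall z r = (Set.range f ∩ Metric.closedBall z r) ∪
      (Set.range g ∩ Metric.closedBall z r) := by
    rw [← Set.union_inter_distrib_right, Set.eq_univ_of_forall h, Set.univ_inter]
  rw [hz]
  exact (boundedlyCompact_range hf z r).union (boundedlyCompact_range hg z r)

/-- Up to an error `2ε/3`, a ball lies in bounded parts of finitely many of the spaces, which are
compact and have finite `ε/3`-nets. Completeness then turns total boundedness into compactness. -/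
theorem properSpace_of_dense_iUnion_range {Y : ℕ → BCM.{v}} {Z : Type u} [MetricSpace Z]
    [CompleteSpace Z] {e : ∀ n, Y n → Z}
    (he : ∀ n, Isometry (e n)) (hd : Dense (⋃ n, Set.range (e n))) (z : Z)
    (h : ∀ R ε : ℝ, 0 < ε → ∃ N, ∀ n, NearOn z R ε (Set.range (e n))
      (⋃ m ∈ Set.Iic N, Set.range (e m))) : ProperSpace Z := by
  refine properSpace_of_forall_isCompact z fun r =>
    TotallyBounded.isCompact_of_isClosed ?_ Metric.isClosed_closedBall
  rw [Metric.totallyBounded_iff]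
  intro ε hε
  have hε3 : 0 < ε / 3 := by positivity
  obtain ⟨N, hN⟩ := h (r + ε / 3) (ε / 3) hε3
  set K : Set Z := ⋃ m ∈ Set.Iic N, (Set.range (e m) ∩ Metric.closedBall z (r + ε)) with hKdef
  have hK : IsCompact K :=
    (Set.finite_Iic N).isCompact_biUnion fun m _ => boundedlyCompact_range (he m) _ _
  obtain ⟨t, -, htf, ht⟩ := hK.finite_cover_balls hε3
  refine ⟨t, htf, fun x hx => ?_⟩
  rw [Metric.mem_closedBall] at hx
  obtain ⟨a, ha, hxa⟩ := Metric.dense_iff.1 hd x (ε / 3) hε3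
  rw [Metric.mem_ball] at ha
  obtain ⟨n, hn⟩ := Set.mem_iUnion.1 hxa
  obtain ⟨b, hb, hab⟩ := hN n a hn (by linarith [dist_triangle a x z])
  simp only [Set.mem_iUnion, Set.mem_Iic, exists_prop] at hb
  obtain ⟨m, hm, hbm⟩ := hb
  have hbK : b ∈ K := by
    simp only [hKdef, Set.mem_iUnion, Set.mem_Iic, exists_prop]
    refine ⟨m, hm, hbm, ?_⟩
    rw [Metric.mem_closedBall]
    linarith [dist_triangle4 b a x z, dist_comm a b]
  have hbt := ht hbK
  simp only [Set.mem_iUnion, exists_prop, Metric.mem_ball] at hbt ⊢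
  obtain ⟨y, hy, hby⟩ := hbt
  exact ⟨y, hy, by linarith [dist_triangle4 x a b y, dist_comm a x]⟩

end Proper

namespace BCM

theorem hom_ext {X Y : BCM.{u}} {f g : X ⟶ Y} (h : ∀ x, f x = g x) : f = g :=
  BCM.Hom.ext (funext h)

theorem dist_map {X Y : BCM.{u}} (f : X ⟶ Y) (x y : X) : dist (f x) (f y) = dist x y :=
  f.isometry.dist_eq x y

theorem boundedlyCompact_range {X Y : BCM.{u}} (f : X ⟶ Y) : BoundedlyCompact (Set.range f.toFun) :=
  _root_.boundedlyCompact_range f.isometry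

theorem exists_glue {X Y W : BCM.{u}} (f : X ⟶ Y) (g : X ⟶ W) :
    ∃ (Z : BCM.{u}) (i : Y ⟶ Z) (j : W ⟶ Z), f ≫ i = g ≫ j := by
  let hf : Isometry f.toFun := f.isometry
  let hg : Isometry g.toFun := g.isometry
  have : ProperSpace (Metric.GlueSpace hf hg) := by
    refine properSpace_of_range_union (Metric.toGlueL_isometry hf hg)
      (Metric.toGlueR_isometry hf hg) fun z => ?_
    obtain ⟨z, rfl⟩ := Quotient.exists_rep z
    rcases z with y | y
    · exact Or.inl ⟨y, rfl⟩
    · exact Or.inr ⟨y, rfl⟩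
  have : Nonempty (Metric.GlueSpace hf hg) := Y.nonempty.map (Metric.toGlueL hf hg)
  refine ⟨BCM.mk (Metric.GlueSpace hf hg), BCM.Hom.mk _ (Metric.toGlueL_isometry hf hg),
    BCM.Hom.mk _ (Metric.toGlueR_isometry hf hg), hom_ext fun x => ?_⟩
  exact congrFun (Metric.toGlue_commute hf hg) x

/-- The disjoint union of two spaces, without a topology. -/
def Cross (X Y : BCM.{u}) : Type u := X ⊕ Y

/-- A prescribed distance between the points of `X` and those of `Y` which satisfies the triangle
inequalities is realized in a boundedly compact space. -/
theorem exists_crossGlue {X Y : BCM.{u}} (c : X → Y → ℝ)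
    (h₁ : ∀ x x' y, c x y ≤ dist x x' + c x' y) (h₂ : ∀ x y y', c x y ≤ c x y' + dist y' y)
    (h₃ : ∀ x x' y, dist x x' ≤ c x y + c x' y) (h₄ : ∀ x y y', dist y y' ≤ c x y + c x y') :
    ∃ (Z : BCM.{u}) (f : X ⟶ Z) (g : Y ⟶ Z), ∀ x y, dist (f x) (g y) = c x y := by
  let d : Cross X Y → Cross X Y → ℝ := fun p q => match p, q with
    | .inl x, .inl x' => dist x x'
    | .inr y, .inr y' => dist y y'
    | .inl x, .inr y => c x y
    | .inr y, .inl x => c x y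
  let m : PseudoMetricSpace (Cross X Y) :=
    { dist := d
      dist_self := by rintro (x | y) <;> exact dist_self _
      dist_comm := by
        rintro (x | y) (x' | y')
        · exact dist_comm x x'
        · rfl
        · rfl
        · exact dist_comm y y'
      dist_triangle := by
        rintro (x | y) (x' | y') (x'' | y'')
        · exact dist_triangle x x' x''
        · exact h₁ x x' y''
        · exact h₃ x x'' y'
        · exact h₂ x y'' y'
        · change c x'' y ≤ c x' y + dist x' x''
          rw [add_comm, dist_comm]; exact h₁ x'' x' y
        · exact h₄ x' y y''
        · change c x'' y ≤ dist y y' + c x'' y'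
          rw [add_comm, dist_comm]; exact h₂ x'' y y'
        · exact dist_triangle y y' y'' }
  let inl : X → Cross X Y := Sum.inl
  let inr : Y → Cross X Y := Sum.inr
  have hf : Isometry fun x : X => (SeparationQuotient.mk (inl x)) :=
    Isometry.of_dist_eq fun x x' => rfl
  have hg : Isometry fun y : Y => (SeparationQuotient.mk (inr y)) :=
    Isometry.of_dist_eq fun y y' => rfl
  have : ProperSpace (SeparationQuotient (Cross X Y)) := by
    refine properSpace_of_range_union hf hg fun z => ?_
    obtain ⟨z, rfl⟩ := SeparationQuotient.surjective_mk z
    rcases z with y | y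
    · exact Or.inl ⟨y, rfl⟩
    · exact Or.inr ⟨y, rfl⟩
  have : Nonempty (SeparationQuotient (Cross X Y)) := X.nonempty.map fun x => SeparationQuotient.mk (inl x)
  exact ⟨BCM.mk (SeparationQuotient (Cross X Y)), BCM.Hom.mk _ hf, BCM.Hom.mk _ hg, fun x y => rfl⟩

/-- Two pairs of embeddings with the same distances between the images factor through a common
pair. -/
theorem exists_span {X Y W W' : BCM.{u}} (l : X ⟶ W) (r : Y ⟶ W) (l' : X ⟶ W') (r' : Y ⟶ W')
    (h : ∀ x y, dist (l x) (r y) = dist (l' x) (r' y)) :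
    ∃ (V : BCM.{u}) (s : X ⟶ V) (t : Y ⟶ V) (i : V ⟶ W) (j : V ⟶ W'),
      s ≫ i = l ∧ t ≫ i = r ∧ s ≫ j = l' ∧ t ≫ j = r' := by
  -- The metric on the union of the two images is determined by `X`, `Y` and the cross distances.
  -- The map to `W'` is well defined because a cross distance vanishes in `W` exactly when it does
  -- in `W'`.
  let V : Set W := Set.range l.toFun ∪ Set.range r.toFun
  let s : X → V := fun x => ⟨l x, Or.inl ⟨x, rfl⟩⟩
  let t : Y → V := fun y => ⟨r y, Or.inr ⟨y, rfl⟩⟩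
  have hs : Isometry s := Isometry.of_dist_eq (dist_map l)
  have ht : Isometry t := Isometry.of_dist_eq (dist_map r)
  have hcov : ∀ z : V, z ∈ Set.range s ∪ Set.range t := by
    rintro ⟨z, ⟨x, rfl⟩ | ⟨y, rfl⟩⟩
    exacts [Or.inl ⟨x, rfl⟩, Or.inr ⟨y, rfl⟩]
  have : ProperSpace V := properSpace_of_range_union hs ht hcov
  have : Nonempty V := X.nonempty.map s
  have hj : ∀ z : V, ∃ z' : W', (∀ x, s x = z → l' x = z') ∧ (∀ y, t y = z → r' y = z') := by
    intro z
    rcases hcov z with ⟨x, rfl⟩ | ⟨y, rfl⟩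
    · refine ⟨l' x, fun x' hx' => by rw [hs.injective hx'], fun y hy => ?_⟩
      have : l x = r y := (congrArg Subtype.val hy).symm
      exact (dist_eq_zero.1 (by rw [← h, this, dist_self])).symm
    · refine ⟨r' y, fun x hx => ?_, fun y' hy' => by rw [ht.injective hy']⟩
      have : l x = r y := congrArg Subtype.val hx
      exact dist_eq_zero.1 (by rw [← h, this, dist_self])
  choose j hjl hjr using hj
  have hjs : ∀ x, j (s x) = l' x := fun x => (hjl _ x rfl).symm
  have hjt : ∀ y, j (t y) = r' y := fun y => (hjr _ y rfl).symm
  have hji : Isometry j := Isometry.of_dist_eq fun z z' => by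
    rcases hcov z with ⟨x, rfl⟩ | ⟨y, rfl⟩ <;> rcases hcov z' with ⟨x', rfl⟩ | ⟨y', rfl⟩
    · rw [hjs, hjs, dist_map, hs.dist_eq]
    · rw [hjs, hjt, ← h]; rfl
    · rw [hjs, hjt, dist_comm, ← h, dist_comm]; rfl
    · rw [hjt, hjt, dist_map, ht.dist_eq]
  exact ⟨BCM.mk V, BCM.Hom.mk s hs, BCM.Hom.mk t ht, BCM.Hom.mk _ isometry_subtype_coe,
    BCM.Hom.mk j hji, rfl, rfl, hom_ext hjs, hom_ext hjt⟩

/-! ### Gluing sequences of spaces along a tree -/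

section Tree

variable {Y : ℕ → BCM.{u}} {p : ℕ → ℕ} {W : ℕ → BCM.{u}}

/-- A space together with maps from all `Y i`. -/
structure Stage (Y : ℕ → BCM.{u}) where
  space : BCM.{u}
  map : ∀ i, Y i → space

/-- Amalgamates the stage with `V` along `Y k`. Maps of a stage whose index has not been reached are
arbitrary, so isometry is claimed only up to that index. -/
theorem exists_stage_succ (n : ℕ) {k : ℕ} (hk : k ≤ n) {V : BCM.{u}} (l : Y k ⟶ V)
    (r : Y (n + 1) ⟶ V) (s : Stage Y) (hs : ∀ i ≤ n, Isometry (s.map i)) :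
    ∃ s' : Stage Y, (∀ i ≤ n + 1, Isometry (s'.map i)) ∧
      (∀ i ≤ n, ∀ j ≤ n, ∀ x y, dist (s'.map i x) (s'.map j y) = dist (s.map i x) (s.map j y)) ∧
      ∀ x y, dist (s'.map k x) (s'.map (n + 1) y) = dist (l x) (r y) := by
  obtain ⟨Z, i, j, hij⟩ := exists_glue (BCM.Hom.mk _ (hs k hk) : Y k ⟶ s.space) l
  let e : ∀ m, Y m → Z := Function.update (fun m y => i (s.map m y)) (n + 1) fun y => j (r y)
  have he : ∀ m ≤ n, e m = fun y => i (s.map m y) := fun m hm =>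
    Function.update_of_ne (by omega) _ _
  have he' : e (n + 1) = fun y => j (r y) := Function.update_self _ _ _
  refine ⟨⟨Z, e⟩, fun m hm => ?_, fun a ha b hb x y => ?_, fun x y => ?_⟩
  · change Isometry (e m)
    rcases hm.lt_or_eq with hm | rfl
    · rw [he m (by omega)]
      exact i.isometry.comp (hs m (by omega))
    · rw [he']
      exact j.isometry.comp r.isometry
  · change dist (e a x) (e b y) = _
    rw [he a ha, he b hb]
    exact dist_map i _ _
  · change dist (e k x) (e (n + 1) y) = _
    rw [he k hk, he']
    have : i (s.map k x) = j (l x) := congrArg (fun f : Y k ⟶ Z => f x) hij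
    simp only [this]
    exact dist_map j _ _

/-- Spaces `Y n` of which each `Y (n + 1)` is glued to some earlier one inside `W n` embed
into a common complete space. -/
theorem exists_treeGlue (hp : ∀ n, p n ≤ n) (l : ∀ n, Y (p n) ⟶ W n) (r : ∀ n, Y (n + 1) ⟶ W n) :
    ∃ (Z : Type u) (_ : MetricSpace Z) (_ : CompleteSpace Z) (e : ∀ n, Y n → Z),
      (∀ n, Isometry (e n)) ∧ Dense (⋃ n, Set.range (e n)) ∧
      ∀ n x y, dist (e (p n) x) (e (n + 1) y) = dist (l n x) (r n y) := by
  have h0 : ∃ s : Stage Y, ∀ i ≤ 0, Isometry (s.map i) := by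
    refine ⟨⟨Y 0, Function.update (fun _ _ => Classical.arbitrary _) 0 id⟩, fun i hi => ?_⟩
    obtain rfl : i = 0 := by omega
    simpa using isometry_id
  obtain ⟨s0, hs0⟩ := h0
  let T : ℕ → Type _ := fun n => {s : Stage Y // ∀ i ≤ n, Isometry (s.map i)}
  have hstep : ∀ n (s : T n), ∃ s' : T (n + 1),
      (∀ i ≤ n, ∀ j ≤ n, ∀ x y,
        dist (s'.1.map i x) (s'.1.map j y) = dist (s.1.map i x) (s.1.map j y)) ∧
      ∀ x y, dist (s'.1.map (p n) x) (s'.1.map (n + 1) y) = dist (l n x) (r n y) := fun n s =>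
    let ⟨s', h, h'⟩ := exists_stage_succ n (hp n) (l n) (r n) s.1 s.2
    ⟨⟨s', h⟩, h'⟩
  choose step hstep₁ hstep₂ using hstep
  let S : ∀ n, T n := fun n => Nat.rec ⟨s0, hs0⟩ step n
  have hS : ∀ i j n m : ℕ, i ≤ n → j ≤ n → n ≤ m → ∀ x y,
      dist ((S m).1.map i x) ((S m).1.map j y) = dist ((S n).1.map i x) ((S n).1.map j y) := by
    intro i j n m hi hj hnm x y
    induction m, hnm using Nat.le_induction with
    | base => rfl
    | succ m hm ih => rw [← ih]; exact hstep₁ m (S m) i (hi.trans hm) j (hj.trans hm) x y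
  -- Distances between two of the spaces stay fixed once both have been attached, so they can be
  -- read off at the stage of the larger index.
  let D : (Σ n, Y n) → (Σ n, Y n) → ℝ := fun a b =>
    dist ((S (max a.1 b.1)).1.map a.1 a.2) ((S (max a.1 b.1)).1.map b.1 b.2)
  have hD : ∀ (a b : Σ n, Y n) (m : ℕ), a.1 ≤ m → b.1 ≤ m →
      D a b = dist ((S m).1.map a.1 a.2) ((S m).1.map b.1 b.2) := fun a b m ha hb =>
    (hS a.1 b.1 (max a.1 b.1) m (le_max_left _ _) (le_max_right _ _) (max_le ha hb) _ _).symm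
  let m : PseudoMetricSpace (Σ n, Y n) :=
    { dist := D
      dist_self := fun a => dist_self _
      dist_comm := fun a b => by
        rw [hD a b (max a.1 b.1) (le_max_left _ _) (le_max_right _ _),
          hD b a (max a.1 b.1) (le_max_right _ _) (le_max_left _ _), dist_comm]
      dist_triangle := fun a b c => by
        have ha : a.1 ≤ max a.1 (max b.1 c.1) := le_max_left _ _
        have hb : b.1 ≤ max a.1 (max b.1 c.1) := (le_max_left _ _).trans (le_max_right _ _)
        have hc : c.1 ≤ max a.1 (max b.1 c.1) := (le_max_right _ _).trans (le_max_right _ _)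
        rw [hD a c _ ha hc, hD a b _ ha hb, hD b c _ hb hc]
        exact dist_triangle _ _ _ }
  refine ⟨UniformSpace.Completion (Σ n, Y n), inferInstance, inferInstance,
    fun n y => ((⟨n, y⟩ : Σ n, Y n) : UniformSpace.Completion (Σ n, Y n)), fun n => ?_, ?_,
    fun n x y => ?_⟩
  · refine Isometry.of_dist_eq fun x y => ?_
    rw [UniformSpace.Completion.dist_eq]
    change D ⟨n, x⟩ ⟨n, y⟩ = _
    rw [hD _ _ n le_rfl le_rfl]
    exact ((S n).2 n le_rfl).dist_eq x y
  · refine UniformSpace.Completion.denseRange_coe.mono ?_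
    rintro _ ⟨⟨n, y⟩, rfl⟩
    exact Set.mem_iUnion.2 ⟨n, y, rfl⟩
  · rw [UniformSpace.Completion.dist_eq]
    change D ⟨p n, x⟩ ⟨n + 1, y⟩ = _
    rw [hD _ _ (n + 1) ((hp n).trans n.le_succ) le_rfl]
    exact hstep₂ n (S n) x y

end Tree

/-- Spaces `Y n` which approach `X` inside spaces `W n` embed together with `X` into a
common boundedly compact space. -/
theorem exists_starGlue {X : BCM.{u}} (x₀ : X) {Y W : ℕ → BCM.{u}} (l : ∀ n, X ⟶ W n)
    (r : ∀ n, Y n ⟶ W n)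
    (h : ∀ R ε : ℝ, 0 < ε → ∀ᶠ n in atTop,
      NearOn (l n x₀) R ε (Set.range (r n).toFun) (Set.range (l n).toFun) ∧
      NearOn (l n x₀) R ε (Set.range (l n).toFun) (Set.range (r n).toFun)) :
    ∃ (Z : BCM.{u}) (f : X ⟶ Z) (g : ∀ n, Y n ⟶ Z),
      (∀ n x y, dist (f x) (g n y) = dist (l n x) (r n y)) ∧
      LocallyTendsto (f x₀) (fun n => Set.range (g n).toFun) (Set.range f.toFun) := by
  -- `X` takes index `0`, each `Y n` takes index `n + 1`, and every later space has parent `0`.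
  let Y' : ℕ → BCM.{u} := fun n => Nat.casesOn n X Y
  obtain ⟨Z, _, _, e, he, hd, hdist⟩ :=
    exists_treeGlue (Y := Y') (p := fun _ => 0) (W := W) (fun _ => Nat.zero_le _) l r
  have hnear : ∀ R ε : ℝ, 0 < ε → ∀ᶠ n in atTop,
      NearOn (e 0 x₀) R ε (Set.range (e (n + 1))) (Set.range (e 0)) ∧
      NearOn (e 0 x₀) R ε (Set.range (e 0)) (Set.range (e (n + 1))) := by
    intro R ε hε
    filter_upwards [h R ε hε] with n hn
    constructor
    · rintro _ ⟨y, rfl⟩ hy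
      rw [dist_comm] at hy
      obtain ⟨_, ⟨x, rfl⟩, hx⟩ := hn.1 (r n y) ⟨y, rfl⟩
        (by rw [dist_comm]; exact (hdist n x₀ y).symm.trans_le hy)
      refine ⟨e 0 x, ⟨x, rfl⟩, ?_⟩
      rw [dist_comm] at hx ⊢
      exact (hdist n x y).trans_lt hx
    · rintro _ ⟨x, rfl⟩ hx
      obtain ⟨_, ⟨y, rfl⟩, hy⟩ := hn.2 (l n x) ⟨x, rfl⟩
        (by rw [(he 0).dist_eq] at hx; rw [dist_map]; exact hx)
      exact ⟨e (n + 1) y, ⟨y, rfl⟩, (hdist n x y).trans_lt hy⟩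
  have : ProperSpace Z := by
    refine properSpace_of_dense_iUnion_range (Y := Y') (e := e) he hd (e 0 x₀) fun R ε hε => ?_
    obtain ⟨N, hN⟩ := eventually_atTop.1 (hnear R ε hε)
    refine ⟨N, fun n a ha haR => ?_⟩
    by_cases hn : n ≤ N
    · exact ⟨a, Set.mem_iUnion₂.2 ⟨n, hn, ha⟩, by simpa using hε⟩
    · obtain ⟨k, rfl⟩ : ∃ k, n = k + 1 := ⟨n - 1, by omega⟩
      obtain ⟨b, hb, hab⟩ := (hN k (by omega)).1 a ha haR
      exact ⟨b, Set.mem_iUnion₂.2 ⟨0, Nat.zero_le N, hb⟩, hab⟩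
  have : Nonempty Z := ⟨e 0 x₀⟩
  exact ⟨BCM.mk Z, BCM.Hom.mk _ (he 0), fun n => BCM.Hom.mk _ (he (n + 1)), hdist, hnear⟩

end BCM

/-! ### Metrizations and common embeddings -/

theorem MTop.map_comp_apply {C : Type w} [Category.{w'} C] (F : C ⥤ MTop.{v}) {X Y Z : C}
    (f : X ⟶ Y) (g : Y ⟶ Z) (a : F.obj X) : F.map (f ≫ g) a = F.map g (F.map f a) := by
  rw [F.map_comp]; rfl

theorem MTop.map_injective {C : Type w} [Category.{w'} C] (F : C ⥤ MTop.{v}) {X Y : C}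
    (f : X ⟶ Y) : Function.Injective (F.map f).toFun := (F.map f).isEmbedding.injective

namespace Metrization

theorem tendsto_iff {C : Type w} [Category.{w'} C] {F : C ⥤ MTop.{v}} (S : Metrization F) (X : C)
    {a : ℕ → F.obj X} {b : F.obj X} :
    Tendsto a atTop (𝓝 b) ↔ Tendsto (fun n => (S.metric X).dist (a n) b) atTop (𝓝 0) := by
  rw [← S.topology_eq X]
  let := S.metric X
  exact tendsto_iff_dist_tendsto_zero

theorem dist_nonneg {C : Type w} [Category.{w'} C] {F : C ⥤ MTop.{v}} (S : Metrization F) (X : C)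
    (a b : F.obj X) : 0 ≤ (S.metric X).dist a b := by
  let := S.metric X
  exact _root_.dist_nonneg

theorem dist_comm {C : Type w} [Category.{w'} C] {F : C ⥤ MTop.{v}} (S : Metrization F) (X : C)
    (a b : F.obj X) : (S.metric X).dist a b = (S.metric X).dist b a :=
  (S.metric X).dist_comm a b

theorem dist_self {C : Type w} [Category.{w'} C] {F : C ⥤ MTop.{v}} (S : Metrization F) (X : C)
    (a : F.obj X) : (S.metric X).dist a a = 0 :=
  (S.metric X).dist_self a

/-- Both pairs of embeddings factor through one space, by `BCM.exists_span`, and the metrization is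
invariant under the two maps out of it. -/
theorem dist_eq_of_cross {F : BCM.{u} ⥤ MTop.{v}} (E : Metrization F) {X Y W W' : BCM.{u}}
    (l : X ⟶ W) (r : Y ⟶ W) (l' : X ⟶ W') (r' : Y ⟶ W')
    (h : ∀ x y, dist (l x) (r y) = dist (l' x) (r' y)) (a : F.obj X) (b : F.obj Y) :
    (E.metric W).dist (F.map l a) (F.map r b) = (E.metric W').dist (F.map l' a) (F.map r' b) := by
  obtain ⟨V, s, t, i, j, rfl, rfl, rfl, rfl⟩ := BCM.exists_span l r l' r' h
  simp only [MTop.map_comp_apply, E.dist_map]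

theorem dist_eq_of_cross_rooted {F : RootedBCM.{u} ⥤ MTop.{v}} (S : Metrization F)
    {X Y W W' : RootedBCM.{u}} (l : X ⟶ W) (r : Y ⟶ W) (l' : X ⟶ W') (r' : Y ⟶ W')
    (h : ∀ x y, dist (l.toHom x) (r.toHom y) = dist (l'.toHom x) (r'.toHom y)) (a : F.obj X)
    (b : F.obj Y) :
    (S.metric W).dist (F.map l a) (F.map r b) = (S.metric W').dist (F.map l' a) (F.map r' b) := by
  obtain ⟨V, s, t, i, j, hl, hr, hl', hr'⟩ := BCM.exists_span l.toHom r.toHom l'.toHom r'.toHom h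
  let V' : RootedBCM.{u} := ⟨V, s X.root⟩
  have hi : i (s X.root) = W.root := by
    rw [← l.map_root, ← hl]; rfl
  let s' : X ⟶ V' := RootedBCM.Hom.mk s rfl
  let t' : Y ⟶ V' := RootedBCM.Hom.mk t <| i.isometry.injective <| by
    change i (t Y.root) = i (s X.root)
    rw [hi, ← r.map_root, ← hr]; rfl
  let i' : V' ⟶ W := RootedBCM.Hom.mk i hi
  let j' : V' ⟶ W' := RootedBCM.Hom.mk j <| by
    change j (s X.root) = _
    rw [← l'.map_root, ← hl']; rfl
  have e1 : l = s' ≫ i' := RootedBCM.Hom.ext hl.symm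
  have e2 : r = t' ≫ i' := RootedBCM.Hom.ext hr.symm
  have e3 : l' = s' ≫ j' := RootedBCM.Hom.ext hl'.symm
  have e4 : r' = t' ≫ j' := RootedBCM.Hom.ext hr'.symm
  rw [e1, e2, e3, e4]
  simp only [MTop.map_comp_apply, S.dist_map]

end Metrization

/-! ### Convergence in the two distances as convergence in a common space -/

section Convergence

variable {τ : Structure.{u, v}}

/-- The class of a decorated space. -/
def RootedSpaces.mk (P : DecoratedBCM τ) : RootedSpaces τ := Quotient.mk _ P

theorem RootedSpaces.exists_rep (x : RootedSpaces τ) : ∃ P, RootedSpaces.mk P = x :=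
  Quotient.exists_rep x

theorem RootedSpaces.mk_eq_mk {P Q : DecoratedBCM τ} :
    RootedSpaces.mk P = RootedSpaces.mk Q ↔ RootedIsometric P Q :=
  Quotient.eq (r := decoratedSetoid τ)

/-- Convergence with non-preserved roots inside a common space. -/
def TendstoNonPreserved (P : ℕ → DecoratedBCM τ) (Q : DecoratedBCM τ) : Prop :=
  ∃ (Z : BCM.{u}) (f : Q.space.toBCM ⟶ Z) (g : ∀ n, (P n).space.toBCM ⟶ Z),
    Tendsto (fun n => g n (P n).space.root) atTop (𝓝 (f Q.space.root)) ∧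
    LocallyTendsto (f Q.space.root) (fun n => Set.range (g n).toFun) (Set.range f.toFun) ∧
    Tendsto (fun n => τ.map (g n) (P n).elt) atTop (𝓝 (τ.map f Q.elt))

/-- Convergence with preserved roots inside a common space. -/
def TendstoPreserved (P : ℕ → DecoratedBCM τ) (Q : DecoratedBCM τ) : Prop :=
  ∃ (Z : RootedBCM.{u}) (f : Q.space ⟶ Z) (g : ∀ n, (P n).space ⟶ Z),
    LocallyTendsto Z.root (fun n => Set.range (g n).toHom.toFun) (Set.range f.toHom.toFun) ∧
    Tendsto (fun n => τ.map (g n).toHom (P n).elt) atTop (𝓝 (τ.map f.toHom Q.elt))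

theorem TendstoPreserved.tendstoNonPreserved {P : ℕ → DecoratedBCM τ} {Q : DecoratedBCM τ}
    (h : TendstoPreserved P Q) : TendstoNonPreserved P Q := by
  obtain ⟨Z, f, g, h, ht⟩ := h
  refine ⟨Z.toBCM, f.toHom, fun n => (g n).toHom, ?_, ?_, ht⟩
  · simp only [(g _).map_root, f.map_root, tendsto_const_nhds]
  · rwa [f.map_root]

/-- The integrals use balls around two different roots. These are eventually less than `1` apart, so
radius `R + 1` around one root covers radius `R` around the other. -/
theorem eventually_nearOn_of_tendsto {X : BCM.{u}} (x : X) {Y W : ℕ → BCM.{u}} (y : ∀ n, Y n)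
    (f : ∀ n, X ⟶ W n) (g : ∀ n, Y n ⟶ W n)
    (hd : Tendsto (fun n => dist (g n (y n)) (f n x)) atTop (𝓝 0))
    (hI : Tendsto (fun n => localHausdorffIntegral (Set.range (g n).toFun) (g n (y n))
      (Set.range (f n).toFun) (f n x)) atTop (𝓝 0)) (R ε : ℝ) (hε : 0 < ε) :
    ∀ᶠ n in atTop, NearOn (f n x) R ε (Set.range (g n).toFun) (Set.range (f n).toFun) ∧
      NearOn (f n x) R ε (Set.range (f n).toFun) (Set.range (g n).toFun) := by
  have hR : 0 ≤ max R 0 + 1 := by positivity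
  have hpos : 0 < min ε 1 * Real.exp (-(max R 0 + 1 + 1)) := by positivity
  filter_upwards [hd.eventually_lt_const one_pos, hI.eventually_lt_const hpos] with n h1 h2
  constructor
  · intro a ha haR
    obtain ⟨b, hb, hab⟩ := nearOn_of_localHausdorffIntegral_lt hR (by positivity)
      (min_le_right _ _) h2 a ha (by
        linarith [dist_triangle_right a (g n (y n)) (f n x), le_max_left R 0])
    exact ⟨b, hb, hab.trans_le (min_le_left _ _)⟩
  · rw [localHausdorffIntegral_comm] at h2
    exact (nearOn_of_localHausdorffIntegral_lt hR (by positivity)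
      (min_le_right _ _) h2).mono (by linarith [le_max_left R 0]) (min_le_left _ _)

theorem nonPreservedValues_nonneg (E : ElementRootedMetrization τ) {P Q : DecoratedBCM τ} {r : ℝ}
    (hr : r ∈ nonPreservedValues E P Q) : 0 ≤ r := by
  obtain ⟨Z, f, g, rfl⟩ := hr
  exact (E.dist_nonneg _ _ _).trans (le_max_right _ _)

theorem preservedValues_nonneg (S : SpaceRootedMetrization τ) {P Q : DecoratedBCM τ} {r : ℝ}
    (hr : r ∈ preservedValues S P Q) : 0 ≤ r := by
  obtain ⟨Z, f, g, rfl⟩ := hr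
  exact (localHausdorffIntegral_nonneg _ _ _ _).trans (le_max_left _ _)

/-- The wedge at the roots, obtained by gluing along a one-point space. It shows that the infima are
taken over non-empty sets. -/
theorem exists_common_rooted (X Y : RootedBCM.{u}) :
    ∃ Z : RootedBCM.{u}, Nonempty (X ⟶ Z) ∧ Nonempty (Y ⟶ Z) := by
  let pt : BCM.{u} := BCM.mk PUnit
  let f : pt ⟶ X.toBCM := BCM.Hom.mk (fun _ => X.root) (isometry_subsingleton)
  let g : pt ⟶ Y.toBCM := BCM.Hom.mk (fun _ => Y.root) (isometry_subsingleton)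
  obtain ⟨Z, i, j, hij⟩ := BCM.exists_glue f g
  refine ⟨⟨Z, i X.root⟩, ⟨RootedBCM.Hom.mk i rfl⟩, ⟨RootedBCM.Hom.mk j ?_⟩⟩
  exact (congrArg (fun h : pt ⟶ Z => h PUnit.unit) hij).symm

theorem preservedValues_nonempty (S : SpaceRootedMetrization τ) (P Q : DecoratedBCM τ) :
    (preservedValues S P Q).Nonempty :=
  let ⟨Z, ⟨f⟩, ⟨g⟩⟩ := exists_common_rooted P.space Q.space
  ⟨_, Z, f, g, rfl⟩

theorem nonPreservedValues_nonempty (E : ElementRootedMetrization τ) (P Q : DecoratedBCM τ) :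
    (nonPreservedValues E P Q).Nonempty :=
  let ⟨Z, ⟨f⟩, ⟨g⟩⟩ := exists_common_rooted P.space Q.space
  ⟨_, Z.toBCM, f.toHom, g.toHom, rfl⟩

theorem preservedDist_mk_nonneg (S : SpaceRootedMetrization τ) (P Q : DecoratedBCM τ) :
    0 ≤ preservedDist S (.mk P) (.mk Q) := Real.sInf_nonneg fun _ => preservedValues_nonneg S

theorem nonPreservedDist_mk_nonneg (E : ElementRootedMetrization τ) (P Q : DecoratedBCM τ) :
    0 ≤ nonPreservedDist E (.mk P) (.mk Q) := Real.sInf_nonneg fun _ => nonPreservedValues_nonneg E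

/-- Infima tending to zero are approached by elements tending to zero. -/
theorem exists_tendsto_of_tendsto_sInf {V : ℕ → Set ℝ} (hne : ∀ n, (V n).Nonempty)
    (h0 : ∀ n, ∀ r ∈ V n, 0 ≤ r) (h : Tendsto (fun n => sInf (V n)) atTop (𝓝 0)) :
    ∃ r : ℕ → ℝ, (∀ n, r n ∈ V n) ∧ Tendsto r atTop (𝓝 0) := by
  have : ∀ n : ℕ, ∃ r ∈ V n, r < sInf (V n) + 1 / ((n : ℝ) + 1) := fun n =>
    exists_lt_of_csInf_lt (hne n) (lt_add_of_pos_right _ (by positivity))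
  choose r hr hlt using this
  refine ⟨r, hr, squeeze_zero (fun n => h0 n _ (hr n)) (fun n => (hlt n).le) ?_⟩
  simpa using h.add tendsto_one_div_add_atTop_nhds_zero_nat

/-- Nearly optimal embeddings into varying `W n` are transported to one space by gluing along `Q`;
the cross distances survive, and with them the `E`-distances. -/
theorem tendstoNonPreserved_of_tendsto_dist (E : ElementRootedMetrization τ)
    {P : ℕ → DecoratedBCM τ} {Q : DecoratedBCM τ}
    (h : Tendsto (fun n => nonPreservedDist E (.mk (P n)) (.mk Q)) atTop (𝓝 0)) :
    TendstoNonPreserved P Q := by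
  obtain ⟨r, hr, hr0⟩ := exists_tendsto_of_tendsto_sInf
    (fun n => nonPreservedValues_nonempty E (P n) Q)
    (fun n _ => nonPreservedValues_nonneg E) h
  choose W g f hrW using hr
  have hd : Tendsto (fun n => dist (g n (P n).space.root) (f n Q.space.root)) atTop (𝓝 0) :=
    squeeze_zero (fun n => dist_nonneg)
      (fun n => (hrW n).ge.trans' ((le_max_left _ _).trans (le_max_left _ _))) hr0
  have hI : Tendsto (fun n => localHausdorffIntegral (Set.range (g n).toFun)
      (g n (P n).space.root) (Set.range (f n).toFun) (f n Q.space.root)) atTop (𝓝 0) :=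
    squeeze_zero (fun n => localHausdorffIntegral_nonneg _ _ _ _)
      (fun n => (hrW n).ge.trans' ((le_max_right _ _).trans (le_max_left _ _))) hr0
  have hE : Tendsto (fun n => (E.metric (W n)).dist (τ.map (g n) (P n).elt, g n (P n).space.root)
      (τ.map (f n) Q.elt, f n Q.space.root)) atTop (𝓝 0) :=
    squeeze_zero (fun n => E.dist_nonneg _ _ _)
      (fun n => (hrW n).ge.trans' (le_max_right _ _)) hr0
  obtain ⟨Z, f', g', hfg, hZ⟩ := BCM.exists_starGlue Q.space.root f g
    (eventually_nearOn_of_tendsto Q.space.root (fun n => (P n).space.root) f g hd hI)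
  have hZE : Tendsto (fun n => ((τ.map (g' n) (P n).elt, g' n (P n).space.root) :
      (elementRooted τ).obj Z)) atTop (𝓝 (τ.map f' Q.elt, f' Q.space.root)) := by
    refine (E.tendsto_iff Z).2 (hE.congr fun n => ?_)
    exact E.dist_eq_of_cross (g n) (f n) (g' n) f'
      (fun y x => by rw [dist_comm, ← hfg, dist_comm])
      ((P n).elt, (P n).space.root) (Q.elt, Q.space.root)
  exact ⟨Z, f', g', (continuous_snd.tendsto _).comp hZE, hZ, (continuous_fst.tendsto _).comp hZE⟩

/-- The common space competes in each infimum. Since `E` is arbitrary, all element-rooted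
metrizations have the same convergent sequences. -/
theorem TendstoNonPreserved.tendsto_dist {P : ℕ → DecoratedBCM τ} {Q : DecoratedBCM τ}
    (h : TendstoNonPreserved P Q) (E : ElementRootedMetrization τ) :
    Tendsto (fun n => nonPreservedDist E (.mk (P n)) (.mk Q)) atTop (𝓝 0) := by
  obtain ⟨Z, f, g, hr, hZ, ht⟩ := h
  have h1 := tendsto_iff_dist_tendsto_zero.1 hr
  have h2 := hZ.tendsto_localHausdorffIntegral hr (fun n => BCM.boundedlyCompact_range (g n))
    (BCM.boundedlyCompact_range f)
  have h3 := (E.tendsto_iff Z).1 (ht.prodMk_nhds hr)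
  refine squeeze_zero (fun n => nonPreservedDist_mk_nonneg E _ _) (fun n => ?_)
    (by simpa using (h1.max h2).max h3)
  exact csInf_le ⟨0, fun _ => nonPreservedValues_nonneg E⟩ ⟨Z, g n, f, rfl⟩

theorem tendstoPreserved_of_tendsto_dist (S : SpaceRootedMetrization τ)
    {P : ℕ → DecoratedBCM τ} {Q : DecoratedBCM τ}
    (h : Tendsto (fun n => preservedDist S (.mk (P n)) (.mk Q)) atTop (𝓝 0)) :
    TendstoPreserved P Q := by
  obtain ⟨r, hr, hr0⟩ := exists_tendsto_of_tendsto_sInf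
    (fun n => preservedValues_nonempty S (P n) Q)
    (fun n _ => preservedValues_nonneg S) h
  choose W g f hrW using hr
  have hd : Tendsto (fun n => dist ((g n).toHom (P n).space.root) ((f n).toHom Q.space.root))
      atTop (𝓝 0) := by
    simp only [(g _).map_root, (f _).map_root, dist_self, tendsto_const_nhds]
  have hI : Tendsto (fun n => localHausdorffIntegral (Set.range (g n).toHom.toFun)
      ((g n).toHom (P n).space.root) (Set.range (f n).toHom.toFun) ((f n).toHom Q.space.root))
      atTop (𝓝 0) := by
    refine squeeze_zero (fun n => localHausdorffIntegral_nonneg _ _ _ _) (fun n => ?_) hr0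
    rw [(g n).map_root, (f n).map_root, hrW n]
    exact le_max_left _ _
  have hS : Tendsto (fun n => (S.metric (W n)).dist (τ.map (g n).toHom (P n).elt)
      (τ.map (f n).toHom Q.elt)) atTop (𝓝 0) :=
    squeeze_zero (fun n => S.dist_nonneg _ _ _)
      (fun n => (hrW n).ge.trans' (le_max_right _ _)) hr0
  obtain ⟨Z, f', g', hfg, hZ⟩ := BCM.exists_starGlue Q.space.root (fun n => (f n).toHom)
    (fun n => (g n).toHom) (eventually_nearOn_of_tendsto Q.space.root
      (fun n => (P n).space.root) _ _ hd hI)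
  let Z' : RootedBCM.{u} := ⟨Z, f' Q.space.root⟩
  let f'' : Q.space ⟶ Z' := RootedBCM.Hom.mk f' rfl
  -- Both roots sit at the root of `W n`; their cross distance is zero, so they still coincide after
  -- gluing.
  let g'' : ∀ n, (P n).space ⟶ Z' := fun n => RootedBCM.Hom.mk (g' n) <| Eq.symm <|
    dist_eq_zero.1 <| (hfg n _ _).trans <| by rw [(g n).map_root, (f n).map_root, dist_self]
  refine ⟨Z', f'', g'', hZ, ?_⟩
  refine (S.tendsto_iff Z').2 (hS.congr fun n => ?_)
  exact S.dist_eq_of_cross_rooted (g n) (f n) (g'' n) f''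
    (fun y x => by rw [dist_comm, ← hfg, dist_comm]) (P n).elt Q.elt

theorem TendstoPreserved.tendsto_dist {P : ℕ → DecoratedBCM τ} {Q : DecoratedBCM τ}
    (h : TendstoPreserved P Q) (S : SpaceRootedMetrization τ) :
    Tendsto (fun n => preservedDist S (.mk (P n)) (.mk Q)) atTop (𝓝 0) := by
  obtain ⟨Z, f, g, hZ, ht⟩ := h
  have h2 := hZ.tendsto_localHausdorffIntegral tendsto_const_nhds
    (fun n => BCM.boundedlyCompact_range (g n).toHom) (BCM.boundedlyCompact_range f.toHom)
  have h3 := (S.tendsto_iff Z).1 ht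
  refine squeeze_zero (fun n => preservedDist_mk_nonneg S _ _) (fun n => ?_)
    (by simpa using h2.max h3)
  exact csInf_le ⟨0, fun _ => preservedValues_nonneg S⟩ ⟨Z, g n, f, rfl⟩

end Convergence

/-! ### Limits of isometric embeddings -/

namespace BCM

/-- A sequence of isometric embeddings with bounded images of one point has a subsequence which
converges uniformly on compact sets. -/
theorem exists_subseq_tendstoUniformlyOn {X Z : BCM.{u}} (g : ℕ → (X ⟶ Z)) (x₀ : X) {z : Z}
    (h : Tendsto (fun n => g n x₀) atTop (𝓝 z)) :
    ∃ φ : ℕ → ℕ, StrictMono φ ∧ ∃ g' : X ⟶ Z, ∀ K : Set X, IsCompact K →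
      TendstoUniformlyOn (fun n => (g (φ n)).toFun) g'.toFun atTop K := by
  -- Arzelà–Ascoli: the values on a dense sequence lie in a compact product of balls. As all maps
  -- are isometries, convergence there spreads to every point and is uniform on compact sets.
  obtain ⟨d, hd⟩ := TopologicalSpace.exists_dense_seq X
  obtain ⟨C, hC⟩ := (Metric.isBounded_range_of_tendsto _ h).subset_closedBall z
  have hmem : ∀ n, (fun i => g n (d i)) ∈
      Set.univ.pi fun i => Metric.closedBall z (C + dist (d i) x₀) := fun n i _ => by
    have h1 : dist (g n x₀) z ≤ C := hC ⟨n, rfl⟩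
    have h2 := dist_map (g n) (d i) x₀
    rw [Metric.mem_closedBall]
    linarith [dist_triangle (g n (d i)) (g n x₀) z]
  obtain ⟨a, -, φ, hφ, ha⟩ :=
    (isCompact_univ_pi fun i => isCompact_closedBall z (C + dist (d i) x₀)).tendsto_subseq hmem
  rw [tendsto_pi_nhds] at ha
  have hcau : ∀ x, CauchySeq fun n => g (φ n) x := fun x => by
    rw [Metric.cauchySeq_iff]
    intro ε hε
    have hε3 : 0 < ε / 3 := by positivity
    obtain ⟨i, hi⟩ := hd.exists_dist_lt x hε3
    obtain ⟨N, hN⟩ := Metric.cauchySeq_iff.1 (ha i).cauchySeq (ε / 3) hε3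
    refine ⟨N, fun m hm n hn => ?_⟩
    have h1 : dist (g (φ m) (d i)) (g (φ n) (d i)) < ε / 3 := hN m hm n hn
    have h2 := dist_map (g (φ m)) x (d i)
    have h3 := dist_map (g (φ n)) (d i) x
    linarith [dist_triangle4 (g (φ m) x) (g (φ m) (d i)) (g (φ n) (d i)) (g (φ n) x),
      dist_comm x (d i)]
  choose g' hg' using fun x => cauchySeq_tendsto_of_complete (hcau x)
  have hiso : Isometry g' := Isometry.of_dist_eq fun x y => by
    refine tendsto_nhds_unique ((hg' x).dist (hg' y)) ?_
    simp only [dist_map, tendsto_const_nhds]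
  refine ⟨φ, hφ, BCM.Hom.mk g' hiso, fun K hK => ?_⟩
  rw [Metric.tendstoUniformlyOn_iff]
  intro ε hε
  refine hK.induction_on (p := fun K => ∀ᶠ n in atTop, ∀ x ∈ K, dist (g' x) (g (φ n) x) < ε)
    (by simp) (fun s t hst ht => ht.mono fun n hn b hb => hn b (hst hb))
    (fun s t hs ht => ?_) (fun x _ => ?_)
  · filter_upwards [hs, ht] with n hn hn' b hb
    exact hb.elim (hn b) (hn' b)
  · have hε3 : 0 < ε / 3 := by positivity
    refine ⟨Metric.ball x (ε / 3), mem_nhdsWithin_of_mem_nhds (Metric.ball_mem_nhds x hε3), ?_⟩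
    filter_upwards [Metric.tendsto_nhds.1 (hg' x) (ε / 3) hε3] with n hn y hy
    rw [Metric.mem_ball] at hy
    have h1 := hiso.dist_eq y x
    have h2 := dist_map (g (φ n)) x y
    linarith [dist_triangle4 (g' y) (g' x) (g (φ n) x) (g (φ n) y), dist_comm x y,
      dist_comm (g' x) (g (φ n) x)]

theorem tendsto_of_tendstoUniformlyOn {X Z : BCM.{u}} {g : ℕ → (X ⟶ Z)} {g' : X ⟶ Z}
    (h : ∀ K : Set X, IsCompact K → TendstoUniformlyOn (fun n => (g n).toFun) g'.toFun atTop K)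
    (x : X) : Tendsto (fun n => g n x) atTop (𝓝 (g' x)) :=
  (h {x} isCompact_singleton).tendsto_at (Set.mem_singleton x)

end BCM

/-! ### Triangle inequality and separation of points -/

section Separation

variable {τ : Structure.{u, v}}

/-- A subsequence of the embeddings of `P` converges to some `g'`. Local Hausdorff convergence gives
`g'` the same image as `f`, and continuity identifies the elements, so `f⁻¹ ∘ g'` is the required
isometry. -/
theorem TendstoNonPreserved.rootedIsometric (hτ : IsEmbeddingContinuous τ) {P Q : DecoratedBCM τ}
    (h : TendstoNonPreserved (fun _ => P) Q) : RootedIsometric P Q := by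
  obtain ⟨Z, f, g, hr, hZ, ht⟩ := h
  obtain ⟨φ, hφ, g', hg'⟩ := BCM.exists_subseq_tendstoUniformlyOn g P.space.root hr
  have hφt := hφ.tendsto_atTop
  have hpt := BCM.tendsto_of_tendstoUniformlyOn hg'
  have hroot : g' P.space.root = f Q.space.root :=
    tendsto_nhds_unique (hpt _) (hr.comp hφt)
  have helt : τ.map g' P.elt = τ.map f Q.elt :=
    tendsto_nhds_unique (hτ _ _ _ _ hg' P.elt) (ht.comp hφt)
  have hsub : ∀ x, g' x ∈ Set.range f.toFun := fun x => by
    rw [← f.isometry.isClosedEmbedding.isClosed_range.closure_eq, Metric.mem_closure_iff]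
    intro ε hε
    obtain ⟨n, hn, hn'⟩ := ((hφt.eventually (hZ (dist x P.space.root + 1) (ε / 2)
      (half_pos hε))).and ((Metric.tendsto_nhds.1 (hpt x) (ε / 2) (half_pos hε)).and
        (Metric.tendsto_nhds.1 (hr.comp hφt) 1 one_pos))).exists
    obtain ⟨b, hb, hab⟩ := hn.1 (g (φ n) x) ⟨x, rfl⟩ (by
      have h1 := BCM.dist_map (g (φ n)) x P.space.root
      have h2 : dist (g (φ n) P.space.root) (f Q.space.root) < 1 := hn'.2
      linarith [dist_triangle (g (φ n) x) (g (φ n) P.space.root) (f Q.space.root)])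
    exact ⟨b, hb, by linarith [dist_triangle_left (g' x) b (g (φ n) x), hn'.1]⟩
  -- The points of `P` that approximate `f y` vary with `n` but stay in a fixed ball, where
  -- convergence to `g'` is uniform. In its radius, `2` is `1` for the approximation plus `1` for
  -- the displacement of the root.
  have hsup : ∀ y, f y ∈ Set.range g'.toFun := fun y => by
    rw [← g'.isometry.isClosedEmbedding.isClosed_range.closure_eq, Metric.mem_closure_iff]
    intro ε hε
    have hmin : 0 < min (ε / 2) 1 := lt_min (half_pos hε) one_pos
    have hu := Metric.tendstoUniformlyOn_iff.1 (hg' (Metric.closedBall P.space.root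
      (dist y Q.space.root + 2)) (isCompact_closedBall _ _)) (ε / 2) (half_pos hε)
    obtain ⟨n, hn, hn'⟩ := ((hφt.eventually (hZ (dist (f y) (f Q.space.root)) _ hmin)).and (hu.and
        (Metric.tendsto_nhds.1 (hr.comp hφt) 1 one_pos))).exists
    obtain ⟨_, ⟨x, rfl⟩, hab⟩ := hn.2 (f y) ⟨y, rfl⟩ le_rfl
    rw [lt_min_iff] at hab
    refine ⟨g' x, ⟨x, rfl⟩, ?_⟩
    have h3 := hn'.1 x (by
      have h1 := BCM.dist_map (g (φ n)) x P.space.root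
      have h2 : dist (g (φ n) P.space.root) (f Q.space.root) < 1 := hn'.2
      have h4 := BCM.dist_map f y Q.space.root
      have h5 : dist (f y) (g (φ n) x) < 1 := hab.2
      rw [Metric.mem_closedBall]
      linarith [dist_triangle4 (g (φ n) x) (f y) (f Q.space.root) (g (φ n) P.space.root),
        dist_comm (f y) (g (φ n) x), dist_comm (g (φ n) P.space.root) (f Q.space.root)])
    have h6 : dist (f y) (g (φ n) x) < ε / 2 := hab.1
    linarith [dist_triangle_right (f y) (g' x) (g (φ n) x)]
  choose k hk using hsub
  have hki : Isometry k := Isometry.of_dist_eq fun x y => by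
    rw [← BCM.dist_map f]
    rw [hk, hk, BCM.dist_map]
  let k' : P.space.toBCM ⟶ Q.space.toBCM := BCM.Hom.mk k hki
  have hkf : k' ≫ f = g' := BCM.hom_ext hk
  refine ⟨RootedBCM.Hom.mk k' ?_, fun y => ?_, ?_⟩
  · exact f.isometry.injective ((hk _).trans hroot)
  · obtain ⟨x, hx⟩ := hsup y
    exact ⟨x, f.isometry.injective ((hk x).trans hx)⟩
  · refine MTop.map_injective τ f ?_
    change τ.map f (τ.map k' P.elt) = τ.map f Q.elt
    rw [← MTop.map_comp_apply, hkf, helt]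

theorem csInf_le_csInf_add_csInf {A B C : Set ℝ} (hA : A.Nonempty) (hB : B.Nonempty)
    (hC : BddBelow C) (h : ∀ a ∈ A, ∀ b ∈ B, ∃ c ∈ C, c ≤ a + b) : sInf C ≤ sInf A + sInf B := by
  have h1 : ∀ a ∈ A, sInf C - a ≤ sInf B := fun a ha => le_csInf hB fun b hb => by
    obtain ⟨c, hc, hcab⟩ := h a ha b hb
    linarith [csInf_le hC hc]
  have h2 : sInf C - sInf B ≤ sInf A := le_csInf hA fun a ha => by linarith [h1 a ha]
  linarith

theorem localHausdorffIntegral_range_comp {X Y Z W : BCM.{u}} (f : X ⟶ Z) (g : Y ⟶ Z) (i : Z ⟶ W)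
    (x y : Z) : localHausdorffIntegral (Set.range (f ≫ i).toFun) (i x) (Set.range (g ≫ i).toFun)
      (i y) = localHausdorffIntegral (Set.range f.toFun) x (Set.range g.toFun) y := by
  rw [← localHausdorffIntegral_image i.isometry, ← Set.range_comp, ← Set.range_comp]
  rfl

/-- With the two ambient spaces glued along `Q`, each of the three terms obeys the triangle
inequality through the image of `Q`. -/
theorem exists_nonPreservedValues_le_add (E : ElementRootedMetrization τ) {P Q R : DecoratedBCM τ}
    {a b : ℝ} (ha : a ∈ nonPreservedValues E P Q) (hb : b ∈ nonPreservedValues E Q R) :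
    ∃ c ∈ nonPreservedValues E P R, c ≤ a + b := by
  obtain ⟨Z₁, f₁, g₁, rfl⟩ := ha
  obtain ⟨Z₂, f₂, g₂, rfl⟩ := hb
  obtain ⟨Z, i, j, hij⟩ := BCM.exists_glue g₁ f₂
  have hroot : i (g₁ Q.space.root) = j (f₂ Q.space.root) :=
    congrArg (fun h : Q.space.toBCM ⟶ Z => h Q.space.root) hij
  refine ⟨_, ⟨Z, f₁ ≫ i, g₂ ≫ j, rfl⟩, ?_⟩
  refine max_le (max_le ?_ ?_) ?_
  · refine le_trans ?_ (add_le_add ((le_max_left _ _).trans (le_max_left _ _))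
      ((le_max_left _ _).trans (le_max_left _ _)))
    change dist (i (f₁ P.space.root)) (j (g₂ R.space.root)) ≤
      dist (f₁ P.space.root) (g₁ Q.space.root) + dist (f₂ Q.space.root) (g₂ R.space.root)
    rw [← BCM.dist_map i, ← BCM.dist_map j, hroot]
    exact dist_triangle _ _ _
  · refine le_trans ?_ (add_le_add ((le_max_right _ _).trans (le_max_left _ _))
      ((le_max_right _ _).trans (le_max_left _ _)))
    refine (localHausdorffIntegral_triangle (BCM.boundedlyCompact_range _)
      (BCM.boundedlyCompact_range (g₁ ≫ i)) _ (i (g₁ Q.space.root)) _).trans ?_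
    refine add_le_add (localHausdorffIntegral_range_comp _ _ _ _ _).le ?_
    rw [hij, hroot]
    exact (localHausdorffIntegral_range_comp _ _ _ _ _).le
  · refine le_trans ?_ (add_le_add (le_max_right _ _) (le_max_right _ _))
    let p : (elementRooted τ).obj P.space.toBCM := (P.elt, P.space.root)
    let q : (elementRooted τ).obj Q.space.toBCM := (Q.elt, Q.space.root)
    let r : (elementRooted τ).obj R.space.toBCM := (R.elt, R.space.root)
    change (E.metric Z).dist ((elementRooted τ).map (f₁ ≫ i) p) ((elementRooted τ).map (g₂ ≫ j) r) ≤
      (E.metric Z₁).dist ((elementRooted τ).map f₁ p) ((elementRooted τ).map g₁ q) +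
      (E.metric Z₂).dist ((elementRooted τ).map f₂ q) ((elementRooted τ).map g₂ r)
    rw [← E.dist_map i, ← E.dist_map j]
    simp only [← MTop.map_comp_apply]
    rw [← hij]
    exact (E.metric Z).dist_triangle _ _ _

theorem exists_preservedValues_le_add (S : SpaceRootedMetrization τ) {P Q R : DecoratedBCM τ}
    {a b : ℝ} (ha : a ∈ preservedValues S P Q) (hb : b ∈ preservedValues S Q R) :
    ∃ c ∈ preservedValues S P R, c ≤ a + b := by
  obtain ⟨Z₁, f₁, g₁, rfl⟩ := ha
  obtain ⟨Z₂, f₂, g₂, rfl⟩ := hb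
  obtain ⟨Z, i, j, hij⟩ := BCM.exists_glue g₁.toHom f₂.toHom
  have hroot : i Z₁.root = j Z₂.root := by
    rw [← g₁.map_root, ← f₂.map_root]
    exact congrArg (fun h : Q.space.toBCM ⟶ Z => h Q.space.root) hij
  let Z' : RootedBCM.{u} := ⟨Z, i Z₁.root⟩
  let i' : Z₁ ⟶ Z' := RootedBCM.Hom.mk i rfl
  let j' : Z₂ ⟶ Z' := RootedBCM.Hom.mk j hroot.symm
  have hij' : g₁ ≫ i' = f₂ ≫ j' := RootedBCM.Hom.ext hij
  refine ⟨_, ⟨Z', f₁ ≫ i', g₂ ≫ j', rfl⟩, max_le ?_ ?_⟩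
  · refine le_trans ?_ (add_le_add (le_max_left _ _) (le_max_left _ _))
    refine (localHausdorffIntegral_triangle (BCM.boundedlyCompact_range (f₁ ≫ i').toHom)
      (BCM.boundedlyCompact_range (g₁ ≫ i').toHom) _ (i Z₁.root) _).trans ?_
    refine add_le_add (localHausdorffIntegral_range_comp f₁.toHom g₁.toHom i _ _).le ?_
    rw [hij']
    change localHausdorffIntegral _ (i Z₁.root) _ (i Z₁.root) ≤ _
    rw [hroot]
    exact (localHausdorffIntegral_range_comp f₂.toHom g₂.toHom j _ _).le
  · refine le_trans ?_ (add_le_add (le_max_right _ _) (le_max_right _ _))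
    let p : (spaceRooted τ).obj P.space := P.elt
    let q : (spaceRooted τ).obj Q.space := Q.elt
    let r : (spaceRooted τ).obj R.space := R.elt
    change (S.metric Z').dist ((spaceRooted τ).map (f₁ ≫ i') p) ((spaceRooted τ).map (g₂ ≫ j') r) ≤
      (S.metric Z₁).dist ((spaceRooted τ).map f₁ p) ((spaceRooted τ).map g₁ q) +
      (S.metric Z₂).dist ((spaceRooted τ).map f₂ q) ((spaceRooted τ).map g₂ r)
    rw [← S.dist_map i', ← S.dist_map j']
    simp only [← MTop.map_comp_apply]
    rw [← hij']
    exact (S.metric Z').dist_triangle _ _ _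

theorem preservedValues_comm (S : SpaceRootedMetrization τ) (P Q : DecoratedBCM τ) :
    preservedValues S P Q ⊆ preservedValues S Q P := by
  rintro _ ⟨Z, f, g, rfl⟩
  refine ⟨Z, g, f, ?_⟩
  rw [localHausdorffDist, localHausdorffIntegral_comm]
  exact congrArg _ (S.dist_comm Z _ _)

theorem nonPreservedValues_comm (E : ElementRootedMetrization τ) (P Q : DecoratedBCM τ) :
    nonPreservedValues E P Q ⊆ nonPreservedValues E Q P := by
  rintro _ ⟨Z, f, g, rfl⟩
  refine ⟨Z, g, f, ?_⟩
  rw [localHausdorffProdDist, localHausdorffProdDist, localHausdorffIntegral_comm,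
    dist_comm (f P.space.root)]
  exact congrArg _ (E.dist_comm Z _ _)

/-- The metric with preserved roots. -/
@[reducible]
noncomputable def preservedMetric (hτ : IsEmbeddingContinuous τ) (S : SpaceRootedMetrization τ) :
    MetricSpace (RootedSpaces τ) where
  dist := preservedDist S
  dist_self := by
    rintro ⟨P⟩
    refine le_antisymm (csInf_le ⟨0, fun _ => preservedValues_nonneg S⟩
      ⟨P.space, 𝟙 _, 𝟙 _, ?_⟩) (preservedDist_mk_nonneg S P P)
    exact (max_self 0).symm.trans
      (congrArg₂ max (localHausdorffIntegral_self _ _).symm (S.dist_self _ _).symm)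
  dist_comm := by
    rintro ⟨P⟩ ⟨Q⟩
    exact congrArg sInf (Set.Subset.antisymm (preservedValues_comm S P Q)
      (preservedValues_comm S Q P))
  dist_triangle := by
    rintro ⟨P⟩ ⟨Q⟩ ⟨R⟩
    exact csInf_le_csInf_add_csInf (preservedValues_nonempty S P Q)
      (preservedValues_nonempty S Q R) ⟨0, fun _ => preservedValues_nonneg S⟩
      fun a ha b hb => exists_preservedValues_le_add S ha hb
  eq_of_dist_eq_zero := by
    rintro ⟨P⟩ ⟨Q⟩ h
    -- Distance zero says that the constant sequence `P` converges to `Q`.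
    refine Quotient.sound ((tendstoPreserved_of_tendsto_dist S (P := fun _ => P) (Q := Q)
      ?_).tendstoNonPreserved.rootedIsometric hτ)
    exact tendsto_const_nhds.congr fun _ => h.symm

/-- The metric with non-preserved roots. -/
@[reducible]
noncomputable def nonPreservedMetric (hτ : IsEmbeddingContinuous τ)
    (E : ElementRootedMetrization τ) : MetricSpace (RootedSpaces τ) where
  dist := nonPreservedDist E
  dist_self := by
    rintro ⟨P⟩
    refine le_antisymm (csInf_le ⟨0, fun _ => nonPreservedValues_nonneg E⟩
      ⟨P.space.toBCM, 𝟙 _, 𝟙 _, ?_⟩) (nonPreservedDist_mk_nonneg E P P)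
    exact (max_self 0).symm.trans (congrArg₂ max ((max_self 0).symm.trans (congrArg₂ max
      (dist_self _).symm (localHausdorffIntegral_self _ _).symm)) (E.dist_self _ _).symm)
  dist_comm := by
    rintro ⟨P⟩ ⟨Q⟩
    exact congrArg sInf (Set.Subset.antisymm (nonPreservedValues_comm E P Q)
      (nonPreservedValues_comm E Q P))
  dist_triangle := by
    rintro ⟨P⟩ ⟨Q⟩ ⟨R⟩
    exact csInf_le_csInf_add_csInf (nonPreservedValues_nonempty E P Q)
      (nonPreservedValues_nonempty E Q R) ⟨0, fun _ => nonPreservedValues_nonneg E⟩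
      fun a ha b hb => exists_nonPreservedValues_le_add E ha hb
  eq_of_dist_eq_zero := by
    rintro ⟨P⟩ ⟨Q⟩ h
    refine Quotient.sound ((tendstoNonPreserved_of_tendsto_dist E (P := fun _ => P) (Q := Q)
      ?_).rootedIsometric hτ)
    exact tendsto_const_nhds.congr fun _ => h.symm

end Separation

/-! ### Merging the roots -/

section Stable

variable {τ : Structure.{u, v}}

/-- Two embedded spaces can be moved so that a point of the first coincides with a point
of the second, while distances grow at most by the distance of these points. -/
theorem BCM.exists_merge {X Y Z : BCM.{u}} (f : X ⟶ Z) (g : Y ⟶ Z) (x₀ : X) (y₀ : Y) :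
    ∃ (M : BCM.{u}) (u : X ⟶ M) (v : Y ⟶ M), u x₀ = v y₀ ∧
      (∀ x y, dist (u x) (v y) ≤ dist (f x) (g y) + dist (f x₀) (g y₀)) ∧
      ∀ x y, dist (f x) (g y) ≤ dist (u x) (v y) + dist (f x₀) (g y₀) := by
  set ε := dist (f x₀) (g y₀) with hε
  have hε0 : 0 ≤ ε := dist_nonneg
  -- The cross distance is the shorter of the old one enlarged by `ε` and the path through the
  -- merged point. The summand `ε` pays for the jump between `f x₀` and `g y₀` in the mixed triangle
  -- inequalities.
  obtain ⟨M, u, v, h⟩ := BCM.exists_crossGlue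
    (fun x y => min (dist (f x) (g y) + ε) (dist x x₀ + dist y₀ y))
    (fun x x' y => by
      rw [← min_add_add_left]
      refine min_le_min ?_ ?_
      · linarith [dist_triangle (f x) (f x') (g y), BCM.dist_map f x x']
      · linarith [dist_triangle x x' x₀])
    (fun x y y' => by
      rw [← min_add_add_right]
      refine min_le_min ?_ ?_
      · linarith [dist_triangle (f x) (g y') (g y), BCM.dist_map g y' y]
      · linarith [dist_triangle y₀ y' y])
    (fun x x' y => by
      have h1 := BCM.dist_map f x x'
      have h2 := dist_triangle (f x) (g y) (f x')
      have h3 := dist_triangle (f x) (f x₀) (f x')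
      have h4 := dist_triangle4 (f x) (g y) (g y₀) (f x₀)
      have h5 := dist_triangle4 (f x') (g y) (g y₀) (f x₀)
      have h6 := BCM.dist_map g y₀ y
      have h7 := BCM.dist_map f x x₀
      have h8 := BCM.dist_map f x' x₀
      have h9 := dist_comm (f x₀) (f x')
      have h10 := dist_comm (g y) (f x')
      have h11 := dist_comm (g y₀) (f x₀)
      have h12 := dist_comm (g y) (g y₀)
      rcases min_choice (dist (f x) (g y) + ε) (dist x x₀ + dist y₀ y) with h | h <;>
      rcases min_choice (dist (f x') (g y) + ε) (dist x' x₀ + dist y₀ y) with h' | h' <;>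
      rw [h, h'] <;> linarith [dist_nonneg (x := y₀) (y := y)])
    (fun x y y' => by
      have h1 := BCM.dist_map g y y'
      have h2 := dist_triangle (g y) (f x) (g y')
      have h3 := dist_triangle (g y) (g y₀) (g y')
      have h4 := dist_triangle4 (g y) (f x) (f x₀) (g y₀)
      have h5 := dist_triangle4 (g y') (f x) (f x₀) (g y₀)
      have h6 := BCM.dist_map f x x₀
      have h7 := BCM.dist_map g y₀ y
      have h8 := BCM.dist_map g y₀ y'
      have h9 := dist_comm (g y₀) (g y)
      have h10 := dist_comm (g y) (f x)
      have h11 := dist_comm (g y') (f x)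
      have h12 := dist_comm (g y') (g y₀)
      rcases min_choice (dist (f x) (g y) + ε) (dist x x₀ + dist y₀ y) with h | h <;>
      rcases min_choice (dist (f x) (g y') + ε) (dist x x₀ + dist y₀ y') with h' | h' <;>
      rw [h, h'] <;> linarith [dist_nonneg (x := x) (y := x₀)])
  refine ⟨M, u, v, ?_, fun x y => ?_, fun x y => ?_⟩
  · rw [← dist_eq_zero, h, dist_self, dist_self, add_zero]
    exact min_eq_right (by positivity)
  · rw [h]; exact min_le_left _ _
  · rw [h, ← min_add_add_right]
    refine le_min (by linarith) ?_
    linarith [dist_triangle4 (f x) (f x₀) (g y₀) (g y), BCM.dist_map f x x₀, BCM.dist_map g y₀ y]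

/-- For each `n` the two roots are merged. Cross distances grow by at most the old distance `εₙ` of
the roots, so stability lets the `E`-distance of the elements grow by at most `D εₙ`. The merged
pairs are then glued along `Q`, where the roots coincide exactly. -/
theorem TendstoNonPreserved.tendstoPreserved (hτ : IsStablyMetrizable τ) {P : ℕ → DecoratedBCM τ}
    {Q : DecoratedBCM τ} (h : TendstoNonPreserved P Q) : TendstoPreserved P Q := by
  obtain ⟨E, D, hD0, hD, hE⟩ := hτ
  obtain ⟨Z, f, g, hr, hZ, ht⟩ := h
  choose M a b hab hle hge using fun n =>
    BCM.exists_merge f (g n) Q.space.root (P n).space.root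
  have hε : Tendsto (fun n => nndist (f Q.space.root) (g n (P n).space.root)) atTop (𝓝 0) := by
    have := (tendsto_const_nhds (x := f Q.space.root)).nndist hr
    rwa [nndist_self] at this
  have hε' : ∀ δ > 0, ∀ᶠ n in atTop, dist (f Q.space.root) (g n (P n).space.root) < δ :=
    fun δ hδ => by
      filter_upwards [Metric.tendsto_nhds.1 hr δ hδ] with n hn
      rwa [dist_comm]
  have hnear : ∀ R δ : ℝ, 0 < δ → ∀ᶠ n in atTop,
      NearOn (a n Q.space.root) R δ (Set.range (b n).toFun) (Set.range (a n).toFun) ∧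
      NearOn (a n Q.space.root) R δ (Set.range (a n).toFun) (Set.range (b n).toFun) := by
    intro R δ hδ
    filter_upwards [hZ (R + 1) (δ / 2) (half_pos hδ),
      hε' (min (δ / 2) 1) (lt_min (half_pos hδ) one_pos)] with n hn hn'
    rw [lt_min_iff] at hn'
    constructor
    · rintro _ ⟨y, rfl⟩ hy
      obtain ⟨_, ⟨x, rfl⟩, hx⟩ := hn.1 (g n y) ⟨y, rfl⟩ (by
        rw [dist_comm] at hy ⊢
        linarith [hge n Q.space.root y])
      refine ⟨a n x, ⟨x, rfl⟩, ?_⟩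
      rw [dist_comm] at hx ⊢
      linarith [hle n x y]
    · rintro _ ⟨x, rfl⟩ hx
      obtain ⟨_, ⟨y, rfl⟩, hy⟩ := hn.2 (f x) ⟨x, rfl⟩ (by
        have h1 := BCM.dist_map f x Q.space.root
        have h2 := BCM.dist_map (a n) x Q.space.root
        linarith)
      exact ⟨b n y, ⟨y, rfl⟩, by linarith [hle n x y]⟩
  obtain ⟨Z', f', g', hfg, hZ'⟩ := BCM.exists_starGlue Q.space.root a b hnear
  have hroot : ∀ n, g' n (P n).space.root = f' Q.space.root := fun n => by
    rw [eq_comm, ← dist_eq_zero, hfg, hab, dist_self]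
  let q : (elementRooted τ).obj Q.space.toBCM := (Q.elt, Q.space.root)
  let p : ∀ n, (elementRooted τ).obj (P n).space.toBCM := fun n => ((P n).elt, (P n).space.root)
  have h1 : Tendsto (fun n => (E.metric Z).dist ((elementRooted τ).map f q)
      ((elementRooted τ).map (g n) (p n))) atTop (𝓝 0) := by
    simp only [E.dist_comm Z ((elementRooted τ).map f q)]
    exact (E.tendsto_iff Z).1 (ht.prodMk_nhds hr)
  have hDε : Tendsto (fun n => (D (nndist (f Q.space.root) (g n (P n).space.root)) : ℝ))
      atTop (𝓝 0) := by
    exact NNReal.tendsto_coe.2 (hD.comp hε)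
  have h2 : Tendsto (fun n => (E.metric Z').dist ((elementRooted τ).map (g' n) (p n))
      ((elementRooted τ).map f' q)) atTop (𝓝 0) := by
    refine squeeze_zero (fun n => E.dist_nonneg _ _ _) (fun n => ?_) (by simpa using h1.add hDε)
    rw [E.dist_comm, E.dist_eq_of_cross f' (g' n) (a n) (b n) (hfg n)]
    exact hE _ _ _ _ f (a n) (g n) (b n) (nndist (f Q.space.root) (g n (P n).space.root)) (hle n)
      q (p n)
  have h3 := (E.tendsto_iff Z').2 h2
  exact ⟨⟨Z', f' Q.space.root⟩, RootedBCM.Hom.mk f' rfl,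
    fun n => RootedBCM.Hom.mk (g' n) (hroot n), hZ', (continuous_fst.tendsto _).comp h3⟩

theorem topologicalSpace_eq_of_tendsto_iff {α : Type w} (t t' : TopologicalSpace α)
    (ht : @FirstCountableTopology α t) (ht' : @FirstCountableTopology α t')
    (h : ∀ (x : ℕ → α) (a : α), Tendsto x atTop (@nhds α t a) ↔ Tendsto x atTop (@nhds α t' a)) :
    t = t' := by
  refine le_antisymm (continuous_id_iff_le.1 ?_) (continuous_id_iff_le.1 ?_)
  · exact @SeqContinuous.continuous _ _ t t' _ _ fun x a hx => (h x a).1 hx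
  · exact @SeqContinuous.continuous _ _ t' t _ _ fun x a hx => (h x a).2 hx

theorem tendsto_preservedMetric_iff (hτ : IsEmbeddingContinuous τ) (S : SpaceRootedMetrization τ)
    (P : ℕ → DecoratedBCM τ) (Q : DecoratedBCM τ) :
    Tendsto (fun n => RootedSpaces.mk (P n)) atTop
      (@nhds _ (preservedMetric hτ S).toUniformSpace.toTopologicalSpace (.mk Q)) ↔
      TendstoPreserved P Q := by
  let := preservedMetric hτ S
  rw [tendsto_iff_dist_tendsto_zero]
  exact ⟨fun h => tendstoPreserved_of_tendsto_dist S h, fun h => h.tendsto_dist S⟩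

theorem tendsto_nonPreservedMetric_iff (hτ : IsEmbeddingContinuous τ)
    (E : ElementRootedMetrization τ) (P : ℕ → DecoratedBCM τ) (Q : DecoratedBCM τ) :
    Tendsto (fun n => RootedSpaces.mk (P n)) atTop
      (@nhds _ (nonPreservedMetric hτ E).toUniformSpace.toTopologicalSpace (.mk Q)) ↔
      TendstoNonPreserved P Q := by
  let := nonPreservedMetric hτ E
  rw [tendsto_iff_dist_tendsto_zero]
  exact ⟨fun h => tendstoNonPreserved_of_tendsto_dist E h, fun h => h.tendsto_dist E⟩

theorem firstCountableTopology_of_metric {α : Type w} (m : MetricSpace α) :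
    FirstCountableTopology α := inferInstance

theorem preservedMetric_topology_eq (hc : IsEmbeddingContinuous τ) (hs : IsStablyMetrizable τ)
    (S : SpaceRootedMetrization τ) (E : ElementRootedMetrization τ) :
    (preservedMetric hc S).toUniformSpace.toTopologicalSpace =
      (nonPreservedMetric hc E).toUniformSpace.toTopologicalSpace := by
  refine topologicalSpace_eq_of_tendsto_iff _ _ (firstCountableTopology_of_metric _)
    (firstCountableTopology_of_metric _) fun x a => ?_
  choose P hP using fun n => RootedSpaces.exists_rep (x n)
  obtain rfl : (fun n => RootedSpaces.mk (P n)) = x := funext hP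
  obtain ⟨Q, rfl⟩ := RootedSpaces.exists_rep a
  rw [tendsto_preservedMetric_iff, tendsto_nonPreservedMetric_iff]
  exact ⟨fun h => h.tendstoNonPreserved, fun h => h.tendstoPreserved hs⟩

/-- The space-rooted metrization `d((a, ρ), (b, ρ))`. -/
theorem nonempty_spaceRootedMetrization (E : ElementRootedMetrization τ) :
    Nonempty (SpaceRootedMetrization τ) := by
  let s : ∀ X : RootedBCM.{u}, τ.obj X.toBCM → (elementRooted τ).obj X.toBCM :=
    fun X a => (a, X.root)
  have hs : ∀ X, IsEmbedding (s X) := fun X => isEmbedding_prodMkLeft X.root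
  refine ⟨⟨fun X => @MetricSpace.induced _ _ (s X) (hs X).injective (E.metric X.toBCM),
    fun X => (E.nonempty X.toBCM).map fun p => p.1, fun X => ?_, fun {X Y} f a b => ?_⟩⟩
  · refine Eq.trans ?_ (hs X).eq_induced.symm
    exact congrArg (TopologicalSpace.induced (s X)) (E.topology_eq X.toBCM)
  · have hf : ∀ a, s Y (τ.map f.toHom a) = (elementRooted τ).map f.toHom (s X a) := fun a =>
      Prod.ext rfl f.map_root.symm
    change (E.metric Y.toBCM).dist (s Y (τ.map f.toHom a)) (s Y (τ.map f.toHom b)) =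
      (E.metric X.toBCM).dist (s X a) (s X b)
    exact (congrArg₂ _ (hf a) (hf b)).trans (E.dist_map _ _ _)

end Stable

/-! ### Completeness -/

section CauchySets

theorem hausdorffEDist_image_congr {X Y Z Z' : Type*} [PseudoEMetricSpace Z]
    [PseudoEMetricSpace Z'] {l : X → Z} {r : Y → Z} {l' : X → Z'} {r' : Y → Z'}
    (h : ∀ x y, edist (l x) (r y) = edist (l' x) (r' y)) (s : Set X) (t : Set Y) :
    Metric.hausdorffEDist (l '' s) (r '' t) = Metric.hausdorffEDist (l' '' s) (r' '' t) := by
  have h' : ∀ x y, edist (r y) (l x) = edist (r' y) (l' x) := fun x y => by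
    rw [edist_comm, h, edist_comm]
  simp only [Metric.hausdorffEDist, Metric.infEDist, iSup_image, iInf_image, h, h']

/-- A ball around an image point meets the range in the image of a ball, so only cross distances
enter. General metric spaces are allowed because the chain completion is used before its properness
is known. -/
theorem localHausdorffIntegral_congr_cross {X Y : BCM.{u}} {Z Z' : Type u} [MetricSpace Z]
    [MetricSpace Z'] {l : X → Z} {r : Y → Z} {l' : X → Z'} {r' : Y → Z'} (hl : Isometry l)
    (hr : Isometry r) (hl' : Isometry l') (hr' : Isometry r')
    (h : ∀ x y, dist (l x) (r y) = dist (l' x) (r' y)) (x : X) (y : Y) :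
    localHausdorffIntegral (Set.range l) (l x) (Set.range r) (r y) =
      localHausdorffIntegral (Set.range l') (l' x) (Set.range r') (r' y) := by
  have hb : ∀ {V : BCM.{u}} {W : Type u} [MetricSpace W] {f : V → W}, Isometry f → ∀ a s,
      Set.range f ∩ Metric.closedBall (f a) s = f '' Metric.closedBall a s := by
    intro V W _ f hf a s
    rw [← hf.preimage_closedBall, Set.image_preimage_eq_inter_range, Set.inter_comm]
  simp only [localHausdorffIntegral, hb hl, hb hr, hb hl', hb hr',
    hausdorffEDist_image_congr (fun x y => by rw [edist_dist, edist_dist, h] :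
      ∀ x y, edist (l x) (r y) = edist (l' x) (r' y))]

/-- The limit consists of the points that are eventually approximated. Approximants in later sets of
a point of `A n` stay in a ball around it; they have a cluster point by properness, which lies in
the limit by the Cauchy condition. The last clause keeps the common root. -/
theorem exists_locallyTendsto_of_cauchy {Z : Type u} [MetricSpace Z] [ProperSpace Z]
    {A : ℕ → Set Z} {z : Z} (h : ∀ R ε : ℝ, 0 < ε → ∃ N, ∀ n ≥ N, ∀ m ≥ N,
      NearOn z R ε (A n) (A m)) :
    ∃ B : Set Z, IsClosed B ∧ LocallyTendsto z A B ∧ ∀ x, (∀ n, x ∈ A n) → x ∈ B := by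
  refine ⟨{x | ∀ ε : ℝ, 0 < ε → ∀ᶠ n in atTop, ∃ a ∈ A n, dist x a < ε}, ?_, ?_, ?_⟩
  · refine isClosed_of_closure_subset fun x hx ε hε => ?_
    obtain ⟨y, hy, hxy⟩ := Metric.mem_closure_iff.1 hx (ε / 2) (half_pos hε)
    filter_upwards [hy (ε / 2) (half_pos hε)] with n ⟨a, ha, hya⟩
    exact ⟨a, ha, by linarith [dist_triangle x y a]⟩
  · intro R ε hε
    obtain ⟨N, hN⟩ := h (R + 1) (ε / 2) (half_pos hε)
    filter_upwards [eventually_ge_atTop N] with n hn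
    constructor
    · intro a ha haR
      choose b hb hab using fun k =>
        hN n hn (N + k) (Nat.le_add_right _ _) a ha (by linarith)
      obtain ⟨x, hx, φ, hφ, hlim⟩ := (isCompact_closedBall a (ε / 2)).tendsto_subseq (x := b)
        fun k => by rw [Metric.mem_closedBall, dist_comm]; exact (hab k).le
      rw [Metric.mem_closedBall, dist_comm] at hx
      refine ⟨x, fun δ hδ => ?_, by linarith⟩
      obtain ⟨N', hN'⟩ := h (R + ε) (δ / 2) (half_pos hδ)
      obtain ⟨k, hk, hk'⟩ := ((Metric.tendsto_nhds.1 hlim (δ / 2) (half_pos hδ)).and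
        (hφ.tendsto_atTop.eventually (eventually_ge_atTop N'))).exists
      have hk1 : dist (b (φ k)) x < δ / 2 := hk
      filter_upwards [eventually_ge_atTop N'] with m hm
      obtain ⟨c, hc, hbc⟩ := hN' (N + φ k) (by omega) m hm (b (φ k)) (hb _) (by
        linarith [dist_triangle (b (φ k)) a z, hab (φ k), dist_comm a (b (φ k))])
      exact ⟨c, hc, by linarith [dist_triangle_left x c (b (φ k))]⟩
    · intro x hx hxR
      obtain ⟨m, ⟨a, ha, hxa⟩, hm⟩ := ((hx (min (ε / 2) 1) (lt_min (half_pos hε) one_pos)).and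
        (eventually_ge_atTop N)).exists
      rw [lt_min_iff] at hxa
      obtain ⟨b, hb, hab⟩ := hN m hm n hn a ha (by
        linarith [dist_triangle_left a z x])
      exact ⟨b, hb, by linarith [dist_triangle x a b]⟩
  · intro x hx ε hε
    exact Eventually.of_forall fun n => ⟨x, hx n, by simpa using hε⟩

theorem IsClosed.properSpace_coe {Z : Type u} [MetricSpace Z] [ProperSpace Z] {B : Set Z}
    (hB : IsClosed B) : ProperSpace B :=
  ⟨fun x r => hB.isClosedEmbedding_subtypeVal.isCompact_preimage (isCompact_closedBall (x : Z) r)⟩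

/-- A telescoping geometric sum; the subtracted tail is what makes the induction close. -/
theorem localHausdorffIntegral_le_geometric {Z : Type u} [MetricSpace Z] {A : ℕ → Set Z} {z : Z}
    (hA : ∀ n, BoundedlyCompact (A n))
    (h : ∀ n, localHausdorffIntegral (A n) z (A (n + 1)) z ≤ (1 / 2) ^ n) (n k : ℕ) :
    localHausdorffIntegral (A n) z (A (n + k)) z ≤ 2 * (1 / 2) ^ n - 2 * (1 / 2) ^ (n + k) := by
  induction k with
  | zero => simp [localHausdorffIntegral_self]
  | succ k ih =>
    have h1 := localHausdorffIntegral_triangle (C := A (n + (k + 1))) (hA n) (hA (n + k)) z z z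
    have h2 := h (n + k)
    rw [← add_assoc] at h1 ⊢
    have h3 : ((1 : ℝ) / 2) ^ (n + k + 1) = (1 / 2) ^ (n + k) / 2 := by rw [pow_succ]; ring
    linarith

theorem exists_nearOn_of_geometric {Z : Type u} [MetricSpace Z] {A : ℕ → Set Z} {z : Z}
    (hA : ∀ n, BoundedlyCompact (A n))
    (h : ∀ n, localHausdorffIntegral (A n) z (A (n + 1)) z ≤ (1 / 2) ^ n) (R ε : ℝ) (hε : 0 < ε) :
    ∃ N, ∀ n ≥ N, ∀ m ≥ N, NearOn z R ε (A n) (A m) := by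
  have hpos : 0 < min ε 1 * Real.exp (-(max R 0 + 1)) := by positivity
  have hlim : Tendsto (fun n : ℕ => 2 * (1 / 2 : ℝ) ^ n) atTop (𝓝 0) := by
    simpa using (tendsto_pow_atTop_nhds_zero_of_lt_one (by norm_num)
      (by norm_num : (1 / 2 : ℝ) < 1)).const_mul 2
  obtain ⟨N, hN⟩ := eventually_atTop.1 (hlim.eventually_lt_const hpos)
  have key : ∀ n ≥ N, ∀ m ≥ n,
      localHausdorffIntegral (A n) z (A m) z < min ε 1 * Real.exp (-(max R 0 + 1)) := by
    intro n hn m hm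
    obtain ⟨k, rfl⟩ := Nat.exists_eq_add_of_le hm
    have h1 := localHausdorffIntegral_le_geometric hA h n k
    have h2 : (0 : ℝ) < (1 / 2) ^ (n + k) := by positivity
    linarith [hN n hn]
  refine ⟨N, fun n hn m hm => ?_⟩
  refine (nearOn_of_localHausdorffIntegral_lt (le_max_right R 0) (by positivity)
    (min_le_right _ _) (y := z) ?_).mono (le_max_left _ _) (min_le_left _ _)
  rcases le_total n m with hnm | hnm
  · exact key n hn m hnm
  · rw [localHausdorffIntegral_comm]
    exact key m hm n hnm

end CauchySets

/-! ### Limits of Cauchy sequences of decorated spaces -/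

section Complete

variable {τ : Structure.{u, v}}

/-- Consecutive spaces are glued into a chain, in which all roots coincide. The images are locally
Hausdorff Cauchy, so the completion is proper and they have a limit set. Completeness of `S` yields
a limit element in the ambient space, and upper semicontinuity shows that it comes from the limit
set. -/
theorem exists_tendstoPreserved (hτ : IsUpperSemicontinuous τ) {S : SpaceRootedMetrization τ}
    (hS : S.IsComplete) (P : ℕ → DecoratedBCM τ)
    (h : ∀ n, preservedDist S (.mk (P n)) (.mk (P (n + 1))) < (1 / 2) ^ n) :
    ∃ Q, TendstoPreserved P Q := by
  have hW : ∀ n, ∃ (W : RootedBCM.{u}) (l : (P n).space ⟶ W) (r : (P (n + 1)).space ⟶ W),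
      localHausdorffDist W.root (Set.range l.toHom.toFun) (Set.range r.toHom.toFun) ≤
        (1 / 2) ^ n ∧
      (S.metric W).dist (τ.map l.toHom (P n).elt) (τ.map r.toHom (P (n + 1)).elt) ≤
        (1 / 2) ^ n := fun n => by
    obtain ⟨_, ⟨W, l, r, rfl⟩, hlt⟩ :=
      exists_lt_of_csInf_lt (preservedValues_nonempty S (P n) (P (n + 1))) (h n)
    exact ⟨W, l, r, (le_max_left _ _).trans hlt.le, (le_max_right _ _).trans hlt.le⟩
  choose W l r hI hd using hW
  obtain ⟨Z, _, _, e, he, hdense, hdist⟩ := BCM.exists_treeGlue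
    (Y := fun n => (P n).space.toBCM) (p := fun n => n) (fun n => le_rfl)
    (fun n => (l n).toHom) (fun n => (r n).toHom)
  have hroot : ∀ n, e n (P n).space.root = e 0 (P 0).space.root := fun n => by
    induction n with
    | zero => rfl
    | succ n ih =>
      rw [← ih, eq_comm, ← dist_eq_zero, hdist, (l n).map_root, (r n).map_root, dist_self]
  set z := e 0 (P 0).space.root
  have hA : ∀ n, BoundedlyCompact (Set.range (e n)) := fun n => boundedlyCompact_range (he n)
  have hIZ : ∀ n, localHausdorffIntegral (Set.range (e n)) z (Set.range (e (n + 1))) z ≤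
      (1 / 2) ^ n := fun n => by
    refine le_trans (le_of_eq ?_) (hI n)
    have := localHausdorffIntegral_congr_cross (he n) (he (n + 1)) (l n).toHom.isometry
      (r n).toHom.isometry (hdist n) (P n).space.root (P (n + 1)).space.root
    rw [(l n).map_root, (r n).map_root, hroot, hroot] at this
    exact this
  have hnear := exists_nearOn_of_geometric hA hIZ
  have : ProperSpace Z := by
    refine properSpace_of_dense_iUnion_range (Y := fun n => (P n).space.toBCM) (e := e)
      he hdense z fun R ε hε => ?_
    obtain ⟨N, hN⟩ := hnear R ε hε
    refine ⟨N, fun n a ha haR => ?_⟩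
    rcases le_total n N with hn | hn
    · exact ⟨a, Set.mem_iUnion₂.2 ⟨n, hn, ha⟩, by simpa using hε⟩
    · obtain ⟨b, hb, hab⟩ := hN n hn N le_rfl a ha haR
      exact ⟨b, Set.mem_iUnion₂.2 ⟨N, Set.mem_Iic.2 le_rfl, hb⟩, hab⟩
  have : Nonempty Z := ⟨z⟩
  let Z' : RootedBCM.{u} := ⟨BCM.mk Z, z⟩
  let g : ∀ n, (P n).space ⟶ Z' := fun n => RootedBCM.Hom.mk (BCM.Hom.mk (e n) (he n)) (hroot n)
  obtain ⟨b, hb⟩ : ∃ b : τ.obj Z'.toBCM,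
      Tendsto (fun n => τ.map (g n).toHom (P n).elt) atTop (𝓝 b) := by
    let a : ℕ → (spaceRooted τ).obj Z' := fun n => τ.map (g n).toHom (P n).elt
    let := S.metric Z'
    have := hS Z'
    have hcau : CauchySeq a := by
      refine cauchySeq_of_le_geometric (1 / 2) 1 (by norm_num) fun n => ?_
      rw [one_mul]
      refine le_trans (le_of_eq ?_) (hd n)
      exact S.dist_eq_of_cross_rooted (g n) (g (n + 1)) (l n) (r n) (hdist n) (P n).elt
        (P (n + 1)).elt
    obtain ⟨b, hb⟩ := cauchySeq_tendsto_of_complete hcau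
    exact ⟨b, (S.tendsto_iff Z').2 (tendsto_iff_dist_tendsto_zero.1 hb)⟩
  obtain ⟨B, hBc, hB, hBz⟩ := exists_locallyTendsto_of_cauchy hnear
  have hzB : z ∈ B := hBz z fun n => ⟨_, hroot n⟩
  have : ProperSpace B := hBc.properSpace_coe
  have : Nonempty B := ⟨⟨z, hzB⟩⟩
  let X : RootedBCM.{u} := ⟨BCM.mk B, ⟨z, hzB⟩⟩
  let f : X ⟶ Z' := RootedBCM.Hom.mk (BCM.Hom.mk Subtype.val isometry_subtype_coe) rfl
  have hf : Set.range f.toHom.toFun = B := Subtype.range_coe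
  have hlt : LocallyTendsto Z'.root (fun n => Set.range (g n).toHom.toFun)
      (Set.range f.toHom.toFun) := by
    rw [hf]; exact hB
  obtain ⟨a, ha⟩ := hτ Z'.toBCM _ X.toBCM (fun n => (g n).toHom) f.toHom
    (hlt.fellTendsto (by rw [hf]; exact hBc)) (fun n => (P n).elt) b hb
  refine ⟨⟨X, a⟩, Z', f, g, hlt, ?_⟩
  rw [ha]
  exact hb

theorem completeSpace_preservedMetric (hτ : IsContinuousStructure τ)
    {S : SpaceRootedMetrization τ} (hS : S.IsComplete) :
    @CompleteSpace (RootedSpaces τ) (preservedMetric hτ.1 S).toUniformSpace := by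
  let := preservedMetric hτ.1 S
  refine Metric.complete_of_convergent_controlled_sequences (fun n => (1 / 2) ^ n) (by simp)
    fun x hx => ?_
  choose P hP using fun n => RootedSpaces.exists_rep (x n)
  obtain rfl : (fun n => RootedSpaces.mk (P n)) = x := funext hP
  obtain ⟨Q, hQ⟩ := exists_tendstoPreserved hτ.2.1 hS P fun n => hx n n (n + 1) le_rfl n.le_succ
  exact ⟨.mk Q, (tendsto_preservedMetric_iff hτ.1 S P Q).2 hQ⟩

end Complete

/-! ### Separability -/

namespace RootedBCM

/-- The finite subspace consisting of the root and the points `v i`. -/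
def finiteSub (Z : RootedBCM.{u}) {n : ℕ} (v : Fin n → Z.toBCM) : RootedBCM.{u} :=
  have : Finite ↥(insert Z.root (Set.range v)) := ((Set.finite_range v).insert Z.root).to_subtype
  have : Nonempty ↥(insert Z.root (Set.range v)) := ⟨⟨Z.root, Set.mem_insert _ _⟩⟩
  ⟨BCM.mk ↥(insert Z.root (Set.range v)), ⟨Z.root, Set.mem_insert _ _⟩⟩

/-- The inclusion of a finite subspace. -/
def finiteSubIncl (Z : RootedBCM.{u}) {n : ℕ} (v : Fin n → Z.toBCM) : Z.finiteSub v ⟶ Z :=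
  RootedBCM.Hom.mk (BCM.Hom.mk Subtype.val isometry_subtype_coe) rfl

theorem range_finiteSubIncl (Z : RootedBCM.{u}) {n : ℕ} (v : Fin n → Z.toBCM) :
    Set.range (Z.finiteSubIncl v).toHom.toFun = insert Z.root (Set.range v) := Subtype.range_coe

theorem locallyTendsto_finiteSub_of_dense {Z : RootedBCM.{u}} {d : ℕ → Z.toBCM}
    (hd : DenseRange d) :
    LocallyTendsto Z.root
      (fun n => Set.range (Z.finiteSubIncl fun i : Fin n => d i).toHom.toFun) Set.univ := by
  intro R ε hε
  have h : ∀ᶠ n in atTop, ∀ b ∈ Metric.closedBall Z.root R, ∃ i : Fin n, dist b (d i) < ε := by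
    refine (isCompact_closedBall Z.root R).induction_on
      (p := fun s => ∀ᶠ n in atTop, ∀ b ∈ s, ∃ i : Fin n, dist b (d i) < ε) (by simp)
      (fun s t hst ht => ht.mono fun n hn b hb => hn b (hst hb)) (fun s t hs ht => ?_)
      (fun x _ => ?_)
    · filter_upwards [hs, ht] with n hn hn' b hb
      exact hb.elim (hn b) (hn' b)
    · obtain ⟨i, hi⟩ := hd.exists_dist_lt x (half_pos hε)
      refine ⟨Metric.ball x (ε / 2),
        mem_nhdsWithin_of_mem_nhds (Metric.ball_mem_nhds x (half_pos hε)), ?_⟩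
      filter_upwards [eventually_gt_atTop i] with n hn b hb
      rw [Metric.mem_ball] at hb
      exact ⟨⟨i, hn⟩, by linarith [dist_triangle b x (d i)]⟩
  filter_upwards [h] with n hn
  refine ⟨fun a _ _ => ⟨a, trivial, by simpa using hε⟩, fun b _ hb => ?_⟩
  obtain ⟨i, hi⟩ := hn b hb
  refine ⟨d i, ?_, hi⟩
  rw [range_finiteSubIncl]
  exact Or.inr ⟨i, rfl⟩

theorem locallyTendsto_finiteSub {Z : RootedBCM.{u}} {n : ℕ} {w : ℕ → Fin n → Z.toBCM}
    {v : Fin n → Z.toBCM} (h : Tendsto w atTop (𝓝 v)) :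
    LocallyTendsto Z.root (fun k => Set.range (Z.finiteSubIncl (w k)).toHom.toFun)
      (Set.range (Z.finiteSubIncl v).toHom.toFun) := by
  intro R ε hε
  filter_upwards [Metric.tendsto_nhds.1 h ε hε] with k hk
  rw [dist_pi_lt_iff hε] at hk
  rw [range_finiteSubIncl, range_finiteSubIncl]
  constructor
  · rintro _ (rfl | ⟨i, rfl⟩) -
    · exact ⟨_, Or.inl rfl, by simpa using hε⟩
    · exact ⟨v i, Or.inr ⟨i, rfl⟩, hk i⟩
  · rintro _ (rfl | ⟨i, rfl⟩) -
    · exact ⟨_, Or.inl rfl, by simpa using hε⟩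
    · exact ⟨w k i, Or.inr ⟨i, rfl⟩, by rw [dist_comm]; exact hk i⟩

/-- The space `ℝⁿ` with the supremum norm, rooted at the origin. -/
def coord (n : ℕ) : RootedBCM.{u} := ⟨BCM.mk (ULift.{u} (Fin n) → ℝ), fun _ => (0 : ℝ)⟩

/-- Finite rooted spaces embed into `ℝⁿ`. -/
theorem exists_finiteSub_coord (Z : RootedBCM.{u}) {n : ℕ} (q : Fin n → Z.toBCM) :
    ∃ (v : Fin n → (coord.{u} n).toBCM) (e : Z.finiteSub q ⟶ (coord.{u} n).finiteSub v),
      Function.Surjective e.toHom.toFun := by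
  -- Kuratowski coordinates, shifted so that the root goes to the origin. The `i`-th coordinate
  -- alone realizes the distance to `q i`, and of two distinct points of the finite space one is
  -- some `q i`.
  let κ : Z.toBCM → ULift.{u} (Fin n) → ℝ := fun x i => dist x (q i.down) - dist Z.root (q i.down)
  have hle : ∀ x y, dist (κ x) (κ y) ≤ dist x y := fun x y => by
    refine (dist_pi_le_iff dist_nonneg).2 fun i => ?_
    rw [Real.dist_eq, sub_sub_sub_cancel_right]
    exact abs_dist_sub_le _ _ _
  have hge : ∀ x i, dist x (q i) ≤ dist (κ x) (κ (q i)) := fun x i => by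
    refine le_trans ?_ (dist_le_pi_dist _ _ ⟨i⟩)
    rw [Real.dist_eq, sub_sub_sub_cancel_right, dist_self, sub_zero]
    exact le_abs_self _
  let v : Fin n → (coord.{u} n).toBCM := fun i => κ (q i)
  have hroot : κ Z.root = (coord.{u} n).root := funext fun i => sub_self _
  have hmem : ∀ x : (Z.finiteSub q).toBCM, κ x.1 ∈ insert (coord.{u} n).root (Set.range v) := by
    rintro ⟨x, rfl | ⟨i, rfl⟩⟩
    · exact Or.inl hroot
    · exact Or.inr ⟨i, rfl⟩
  let k : (Z.finiteSub q).toBCM → ((coord.{u} n).finiteSub v).toBCM := fun x => ⟨κ x.1, hmem x⟩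
  have hk : Isometry k := Isometry.of_dist_eq fun x y => by
    refine le_antisymm (hle x.1 y.1) ?_
    obtain ⟨x, hx⟩ := x
    obtain ⟨y, hy⟩ := y
    change dist x y ≤ dist (κ x) (κ y)
    rcases hy with rfl | ⟨i, rfl⟩
    · rcases hx with rfl | ⟨i, rfl⟩
      · simp
      · rw [dist_comm, dist_comm (κ _)]
        exact hge _ i
    · exact hge _ i
  refine ⟨v, RootedBCM.Hom.mk (BCM.Hom.mk k hk) (Subtype.ext hroot), ?_⟩
  rintro ⟨y, rfl | ⟨i, rfl⟩⟩
  · exact ⟨⟨Z.root, Or.inl rfl⟩, Subtype.ext hroot⟩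
  · exact ⟨⟨q i, Or.inr ⟨i, rfl⟩⟩, rfl⟩

end RootedBCM

section Separable

theorem Metrization.exists_dist_lt {C : Type w} [Category.{w'} C] {F : C ⥤ MTop.{v}}
    (S : Metrization F) {X : C} {s : ℕ → F.obj X} (hs : DenseRange s) (b : F.obj X) {ε : ℝ}
    (hε : 0 < ε) : ∃ j, (S.metric X).dist (s j) b < ε := by
  obtain ⟨a, ha, hab⟩ := mem_closure_iff_seq_limit.1 (hs b)
  obtain ⟨n, hn⟩ := (((S.tendsto_iff X).1 hab).eventually_lt_const hε).exists
  obtain ⟨j, hj⟩ := ha n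
  exact ⟨j, hj ▸ hn⟩

variable {τ : Structure.{u, v}}

/-- Lower semicontinuity is used twice: to approximate a decorated space by ones over finite
subspaces, and, for finite subspaces of `ℝⁿ`, to move the vertices into a countable dense set of
tuples. -/
theorem separableSpace_preservedMetric (hτ : IsContinuousStructure τ) (hs : IsSeparableStructure τ)
    (S : SpaceRootedMetrization τ) : @TopologicalSpace.SeparableSpace (RootedSpaces τ)
      (preservedMetric hτ.1 S).toUniformSpace.toTopologicalSpace := by
  let := preservedMetric hτ.1 S
  have : ∀ X : RootedBCM.{u}, Nonempty (τ.obj X.toBCM) := S.nonempty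
  let F : ∀ n : ℕ, (Fin n → (RootedBCM.coord.{u} n).toBCM) → RootedBCM.{u} :=
    fun n v => (RootedBCM.coord.{u} n).finiteSub v
  let D : ∀ n : ℕ, ℕ → Fin n → (RootedBCM.coord.{u} n).toBCM :=
    fun n => TopologicalSpace.denseSeq _
  let c : ∀ X : RootedBCM.{u}, ℕ → τ.obj X.toBCM :=
    fun X => @TopologicalSpace.denseSeq (τ.obj X.toBCM) _ (hs X.toBCM) _
  have hc : ∀ X, DenseRange (c X) := fun X =>
    @TopologicalSpace.denseRange_denseSeq (τ.obj X.toBCM) _ (hs X.toBCM) _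
  let C : ℕ × ℕ × ℕ → RootedSpaces τ := fun t => .mk ⟨F t.1 (D t.1 t.2.1), c _ t.2.2⟩
  have h1 : ∀ n v (a : τ.obj (F n v).toBCM),
      RootedSpaces.mk ⟨F n v, a⟩ ∈ closure (Set.range C) := by
    intro n v a
    obtain ⟨w, hw, hwv⟩ := mem_closure_iff_seq_limit.1 (TopologicalSpace.denseRange_denseSeq _ v)
    choose k hk using hw
    obtain rfl : (fun m => D n (k m)) = w := funext hk
    have hlt := RootedBCM.locallyTendsto_finiteSub hwv
    obtain ⟨φ, hφ, b, hb⟩ := hτ.2.2 (RootedBCM.coord.{u} n).toBCM (fun m => (F n (D n (k m))).toBCM)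
      (F n v).toBCM _ ((RootedBCM.coord.{u} n).finiteSubIncl v).toHom (hlt.fellTendsto
        (BCM.boundedlyCompact_range ((RootedBCM.coord.{u} n).finiteSubIncl v).toHom).isClosed) a
    -- `b m` is replaced by a member of the chosen dense sequence at a cost of `1 / (m + 1)`,
    -- measured over the finite space; the inclusion into `ℝⁿ` preserves this distance.
    choose j hj using fun m : ℕ => S.exists_dist_lt (X := F n (D n (k (φ m))))
      (s := c (F n (D n (k (φ m))))) (hc _) (b m)
      (by positivity : 0 < 1 / ((m : ℝ) + 1))
    have hlim : TendstoPreserved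
        (fun m => (⟨F n (D n (k (φ m))), c (F n (D n (k (φ m)))) (j m)⟩ : DecoratedBCM τ)) ⟨F n v, a⟩ := by
      refine ⟨RootedBCM.coord.{u} n, (RootedBCM.coord.{u} n).finiteSubIncl v,
        fun m => (RootedBCM.coord.{u} n).finiteSubIncl (D n (k (φ m))),
        fun R ε hε => hφ.tendsto_atTop.eventually (hlt R ε hε), ?_⟩
      refine (S.tendsto_iff (RootedBCM.coord.{u} n)).2 ?_
      have hb' := (S.tendsto_iff (RootedBCM.coord.{u} n)).1 hb
      have hsum := tendsto_one_div_add_atTop_nhds_zero_nat.add hb'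
      rw [add_zero] at hsum
      refine squeeze_zero (fun m => S.dist_nonneg _ _ _) (fun m => ?_) hsum
      refine ((S.metric (RootedBCM.coord.{u} n)).dist_triangle _
        (τ.map ((RootedBCM.coord.{u} n).finiteSubIncl (D n (k (φ m)))).toHom (b m)) _).trans
          (add_le_add (le_trans (le_of_eq ?_) (hj m).le) le_rfl)
      exact S.dist_map ((RootedBCM.coord.{u} n).finiteSubIncl (D n (k (φ m)))) _ _
    refine mem_closure_of_tendsto ((tendsto_preservedMetric_iff hτ.1 S _ _).2 hlim)
      (Eventually.of_forall fun m => ⟨(n, k (φ m), j m), rfl⟩)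
  refine ⟨Set.range C, Set.countable_range C, fun x => ?_⟩
  obtain ⟨⟨X, a⟩, rfl⟩ := RootedSpaces.exists_rep x
  obtain ⟨d, hd⟩ := TopologicalSpace.exists_dense_seq X.toBCM
  have hlt := RootedBCM.locallyTendsto_finiteSub_of_dense hd
  have huniv : Set.range (𝟙 X : X ⟶ X).toHom.toFun = Set.univ :=
    Set.range_eq_univ.2 fun x => ⟨x, rfl⟩
  rw [← huniv] at hlt
  obtain ⟨φ, hφ, b, hb⟩ := hτ.2.2 X.toBCM
    (fun n => (X.finiteSub fun i : Fin n => d i).toBCM) X.toBCM _ (𝟙 X : X ⟶ X).toHom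
    (hlt.fellTendsto (by rw [huniv]; exact isClosed_univ)) a
  have hlim : TendstoPreserved
      (fun m => (⟨X.finiteSub fun i : Fin (φ m) => d i, b m⟩ : DecoratedBCM τ)) ⟨X, a⟩ :=
    ⟨X, 𝟙 X, fun m => X.finiteSubIncl fun i : Fin (φ m) => d i,
      fun R ε hε => hφ.tendsto_atTop.eventually (hlt R ε hε), hb⟩
  rw [← isClosed_closure.closure_eq]
  refine mem_closure_of_tendsto ((tendsto_preservedMetric_iff hτ.1 S _ _).2 hlim)
    (Eventually.of_forall fun m => ?_)
  -- The finite subspace is replaced by an isometric copy in `ℝⁿ`, where the countable family lives.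
  obtain ⟨v, e, he⟩ := X.exists_finiteSub_coord fun i : Fin (φ m) => d i
  have : RootedSpaces.mk ⟨X.finiteSub fun i : Fin (φ m) => d i, b m⟩ =
      RootedSpaces.mk (τ := τ) ⟨F (φ m) v, τ.map e.toHom (b m)⟩ :=
    RootedSpaces.mk_eq_mk.2 ⟨e, he, rfl⟩
  rw [this]
  exact h1 _ _ _

end Separable

/-! ### Polishness -/

section Polish

/-- A `G_δ` in a Polish space, as the range of an embedding, is Polish. -/
theorem Topology.IsEmbedding.polishSpace_of_range_eq_iInter {α β : Type*} [TopologicalSpace α]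
    [TopologicalSpace β] [PolishSpace β] {f : α → β} (hf : IsEmbedding f) {U : ℕ → Set β}
    (hU : ∀ k, IsOpen (U k)) (hr : Set.range f = ⋂ k, U k) : PolishSpace α := by
  have : ∀ k, PolishSpace (U k) := fun k => (hU k).polishSpace
  have hmem : ∀ a k, f a ∈ U k := fun a k =>
    Set.mem_iInter.1 (hr ▸ Set.mem_range_self a : f a ∈ ⋂ k, U k) k
  -- The diagonal map into the product of the Polish spaces `U k`; its range is closed, being the
  -- set where all coordinates agree.
  let g : α → ∀ k, U k := fun a k => ⟨f a, hmem a k⟩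
  have hg : Continuous g :=
    continuous_pi fun k => hf.continuous.subtype_mk fun a => hmem a k
  have hval : ∀ k, Continuous fun p : ∀ k, U k => (p k : β) := fun k =>
    continuous_subtype_val.comp (continuous_apply k)
  refine IsClosedEmbedding.polishSpace (f := g) ⟨.of_comp hg (hval 0) hf, ?_⟩
  have hrange : Set.range g = ⋂ k, {p | (p k : β) = p 0} := by
    ext p
    simp only [Set.mem_range, Set.mem_iInter, Set.mem_ofPred_eq]
    constructor
    · rintro ⟨a, rfl⟩ k
      rfl
    · intro hp
      have : (p 0 : β) ∈ Set.range f := by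
        rw [hr, Set.mem_iInter]
        exact fun k => hp k ▸ (p k).2
      obtain ⟨a, ha⟩ := this
      exact ⟨a, funext fun k => Subtype.ext (ha.trans (hp k).symm)⟩
  rw [hrange]
  exact isClosed_iInter fun k => isClosed_eq (hval k) (hval 0)

variable {τ τ' : Structure.{u, v}}

theorem MTop.naturality_apply (η : τ ⟶ τ') {X Y : BCM.{u}} (f : X ⟶ Y) (a : τ.obj X) :
    η.app Y (τ.map f a) = τ'.map f (η.app X a) :=
  congrArg (fun h : τ.obj X ⟶ τ'.obj Y => h a) (η.naturality f)

theorem IsEmbeddingContinuous.of_natTrans (η : τ ⟶ τ') (h : IsEmbeddingContinuous τ') :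
    IsEmbeddingContinuous τ := by
  intro X Y f g hfg a
  rw [(η.app Y).isEmbedding.tendsto_nhds_iff]
  have := h X Y f g hfg (η.app X a)
  simpa only [Function.comp_def, MTop.naturality_apply] using this

/-- The image of a decorated space under a natural transformation. -/
def DecoratedBCM.push (η : τ ⟶ τ') (P : DecoratedBCM τ) : DecoratedBCM τ' :=
  ⟨P.space, η.app P.space.toBCM P.elt⟩

theorem rootedIsometric_push_iff (η : τ ⟶ τ') {P Q : DecoratedBCM τ} :
    RootedIsometric (P.push η) (Q.push η) ↔ RootedIsometric P Q := by
  refine exists_congr fun f => and_congr_right fun _ => ?_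
  have h : τ'.map f.toHom (P.push η).elt = η.app _ (τ.map f.toHom P.elt) :=
    (MTop.naturality_apply η f.toHom P.elt).symm
  rw [h]
  exact (η.app _).isEmbedding.injective.eq_iff

/-- Naturality moves `η` to the common ambient space, where, as an embedding, it preserves and
reflects limits. -/
theorem tendstoPreserved_push_iff (η : τ ⟶ τ') {P : ℕ → DecoratedBCM τ} {Q : DecoratedBCM τ} :
    TendstoPreserved (fun n => (P n).push η) (Q.push η) ↔ TendstoPreserved P Q := by
  refine exists_congr fun Z => exists_congr fun f => exists_congr fun g =>
    and_congr_right fun _ => ?_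
  have h : ∀ (R : DecoratedBCM τ) (k : R.space ⟶ Z),
      τ'.map k.toHom (R.push η).elt = η.app _ (τ.map k.toHom R.elt) :=
    fun R k => (MTop.naturality_apply η k.toHom R.elt).symm
  exact (Iff.of_eq (congrArg₂ (fun a b => Tendsto a atTop (𝓝 b))
    (funext fun n => h (P n) (g n)) (h Q f))).trans
      (η.app _).isEmbedding.tendsto_nhds_iff.symm

/-- The map induced by a natural transformation. -/
def RootedSpaces.push (η : τ ⟶ τ') : RootedSpaces τ → RootedSpaces τ' :=
  Quotient.map (DecoratedBCM.push η) fun _ _ h => (rootedIsometric_push_iff η).2 h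

theorem RootedSpaces.push_mk (η : τ ⟶ τ') (P : DecoratedBCM τ) :
    (RootedSpaces.mk P).push η = .mk (P.push η) := rfl

theorem RootedSpaces.isEmbedding_push (η : τ ⟶ τ') (hτ : IsEmbeddingContinuous τ)
    (hτ' : IsEmbeddingContinuous τ') (S : SpaceRootedMetrization τ)
    (S' : SpaceRootedMetrization τ') :
    @IsEmbedding _ _ (preservedMetric hτ S).toUniformSpace.toTopologicalSpace
      (preservedMetric hτ' S').toUniformSpace.toTopologicalSpace (RootedSpaces.push η) := by
  let := preservedMetric hτ S
  let := preservedMetric hτ' S'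
  refine ⟨⟨?_⟩, fun x y hxy => ?_⟩
  · refine topologicalSpace_eq_of_tendsto_iff _ _ inferInstance
      (TopologicalSpace.firstCountableTopology_induced _ _ _) fun x a => ?_
    choose P hP using fun n => RootedSpaces.exists_rep (x n)
    obtain rfl : (fun n => RootedSpaces.mk (P n)) = x := funext hP
    obtain ⟨Q, rfl⟩ := RootedSpaces.exists_rep a
    rw [nhds_induced, tendsto_comap_iff]
    exact (tendsto_preservedMetric_iff hτ S P Q).trans ((tendstoPreserved_push_iff η).symm.trans
      (tendsto_preservedMetric_iff hτ' S' _ _).symm)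
  · obtain ⟨P, rfl⟩ := RootedSpaces.exists_rep x
    obtain ⟨Q, rfl⟩ := RootedSpaces.exists_rep y
    rw [push_mk, push_mk, mk_eq_mk, rootedIsometric_push_iff] at hxy
    exact mk_eq_mk.2 hxy

/-- The classes of decorated spaces with element in a subfunctor. -/
def RootedSpaces.sub (σ : SubfunctorMTop (spaceRooted τ)) : Set (RootedSpaces τ) :=
  {x | ∃ P, RootedSpaces.mk P = x ∧ P.elt ∈ σ.carrier P.space}

theorem RootedSpaces.mk_mem_sub {σ : SubfunctorMTop (spaceRooted τ)} {P : DecoratedBCM τ} :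
    RootedSpaces.mk P ∈ RootedSpaces.sub σ ↔ P.elt ∈ σ.carrier P.space := by
  refine ⟨?_, fun h => ⟨P, rfl, h⟩⟩
  rintro ⟨Q, hQ, h⟩
  obtain ⟨f, -, hf⟩ := mk_eq_mk.1 hQ
  rw [← hf]
  exact σ.map_mem f Q.elt h

/-- If `P n` tends to `Q` inside `Z` and the element of `Q` belongs to `σ`, the images of the
elements of `P n` eventually enter the open set `σ.carrier Z`. Pullback stability brings this back
to `P n`. -/
theorem RootedSpaces.isOpen_sub (hτ : IsEmbeddingContinuous τ) (S : SpaceRootedMetrization τ)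
    {σ : SubfunctorMTop (spaceRooted τ)} (hp : σ.IsPullbackStable) (ho : σ.IsOpenSub) :
    @IsOpen _ (preservedMetric hτ S).toUniformSpace.toTopologicalSpace (RootedSpaces.sub σ) := by
  let := preservedMetric hτ S
  rw [← isClosed_compl_iff]
  refine IsSeqClosed.isClosed fun x a hx hxa ha => ?_
  choose P hP using fun n => RootedSpaces.exists_rep (x n)
  obtain rfl : (fun n => RootedSpaces.mk (P n)) = x := funext hP
  obtain ⟨Q, rfl⟩ := RootedSpaces.exists_rep a
  obtain ⟨Z, f, g, -, ht⟩ := (tendsto_preservedMetric_iff hτ S P Q).1 hxa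
  have hQ : τ.map f.toHom Q.elt ∈ σ.carrier Z := σ.map_mem f Q.elt (mk_mem_sub.1 ha)
  obtain ⟨n, hn⟩ := (ht.eventually ((ho Z).mem_nhds hQ)).exists
  refine hx n (mk_mem_sub.2 ?_)
  rw [← hp _ _ (g n)]
  exact hn

theorem RootedSpaces.range_push (η : τ ⟶ τ') {σ : ℕ → SubfunctorMTop (spaceRooted τ')}
    (hη : ∀ X : RootedBCM.{u}, Set.range (η.app X.toBCM).toFun = ⋂ k, (σ k).carrier X) :
    Set.range (RootedSpaces.push η) = ⋂ k, RootedSpaces.sub (σ k) := by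
  ext x
  obtain ⟨P, rfl⟩ := RootedSpaces.exists_rep x
  have h1 : RootedSpaces.mk P ∈ ⋂ k, RootedSpaces.sub (σ k) ↔
      P.elt ∈ Set.range (η.app P.space.toBCM).toFun := by
    rw [hη]
    simp only [Set.mem_iInter, mk_mem_sub]
    exact Set.mem_iInter.symm
  rw [h1]
  constructor
  · rintro ⟨y, hy⟩
    obtain ⟨Q, rfl⟩ := RootedSpaces.exists_rep y
    obtain ⟨f, -, hf⟩ := mk_eq_mk.1 hy
    exact ⟨τ.map f.toHom Q.elt, (MTop.naturality_apply η f.toHom Q.elt).trans hf⟩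
  · rintro ⟨a, ha⟩
    refine ⟨.mk ⟨P.space, a⟩, ?_⟩
    rw [push_mk]
    exact congrArg (fun b => RootedSpaces.mk ⟨P.space, b⟩) ha

/-- The space for `τ'` is complete and separable, and the map induced by `η` embeds the space for
`τ` in it as a `G_δ`. -/
theorem polishSpace_preservedMetric (hτ : IsEmbeddingContinuous τ)
    (hp : IsPolishWithPreservedRoots τ) (S : SpaceRootedMetrization τ) :
    @PolishSpace (RootedSpaces τ) (preservedMetric hτ S).toUniformSpace.toTopologicalSpace := by
  obtain ⟨τ', η, σ, hc, hs, ⟨S', hS'⟩, hσ, hη⟩ := hp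
  let := preservedMetric hτ S
  let := preservedMetric hc.1 S'
  have := completeSpace_preservedMetric hc hS'
  have := separableSpace_preservedMetric hc hs S'
  have : PolishSpace (RootedSpaces τ') := inferInstance
  exact (RootedSpaces.isEmbedding_push η hτ hc.1 S S').polishSpace_of_range_eq_iInter
    (fun k => RootedSpaces.isOpen_sub hc.1 S' (hσ k).1 (hσ k).2) (RootedSpaces.range_push η hη)

theorem IsPolishWithPreservedRoots.isEmbeddingContinuous (hp : IsPolishWithPreservedRoots τ) :
    IsEmbeddingContinuous τ := by
  obtain ⟨τ', η, σ, hc, -⟩ := hp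
  exact hc.1.of_natTrans η

end Polish

theorem mainTheorem1 (τ : Structure.{u, v}) (hstable : IsStablyMetrizable τ)
    (hpolish : IsPolishWithPreservedRoots τ) :
    Nonempty (SpaceRootedMetrization τ) ∧ Nonempty (ElementRootedMetrization τ) ∧
    ∀ (S : SpaceRootedMetrization τ) (E : ElementRootedMetrization τ),
      ∃ mP mN : MetricSpace (RootedSpaces τ),
        (∀ x y, mP.dist x y = preservedDist S x y) ∧
        (∀ x y, mN.dist x y = nonPreservedDist E x y) ∧
        mP.toUniformSpace.toTopologicalSpace = mN.toUniformSpace.toTopologicalSpace ∧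
        @PolishSpace (RootedSpaces τ) mP.toUniformSpace.toTopologicalSpace := by
  have hτ := hpolish.isEmbeddingContinuous
  obtain ⟨E₀, -⟩ := id hstable
  exact ⟨nonempty_spaceRootedMetrization E₀, ⟨E₀⟩, fun S E =>
    ⟨preservedMetric hτ S, nonPreservedMetric hτ E, fun _ _ => rfl, fun _ _ => rfl,
      preservedMetric_topology_eq hτ hstable S E, polishSpace_preservedMetric hτ hpolish S⟩⟩
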